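/- A \emph{monadic MV-algebra} is an algebra $\langle \mathbf{A},\exists,\forall\rangle$, where $\mathbf{A}=(A,\oplus,\neg,0)$ is an MV-algebra and $\exists,\forall$ are unary operations on $A$ satisfying the identities \[ \forall x\to x\approx 1,\quad \forall(x\to\forall y)\approx \exists x\to\forall y,\quad \forall(\forall x\to y)\approx\forall x\to\forall y,\quad \forall(\exists x\vee y)\approx\exists x\vee\forall y,\quad \exists(x*x)\approx\exists x*\exists x, \] where $1=\neg 0$, $x\to y=\neg x\oplus y$, $x*y=\neg(\neg x\oplus\neg y)$, $x\vee y=(x\to y)\to y$ and $x\wedge y=x*(x\to y)$. Let $\mathbb{MMV}$ be the variety of monadic MV-algebras, and let $\mathbb{MMV}_{\mathrm{FSI}}$ be the class of its finitely subdirectly irreducible members, i.e. those algebras in which the intersection of two congruences is the identity relation only if one of the two is the identity relation. A class $\mathbb{K}$ of such algebras has the \emph{finite embeddability property} if for every $\mathbf{A}\in\mathbb{K}$ and every finite subset $S\subseteq A$ there are a finite algebra $\mathbf{B}\in\mathbb{K}$ and an injective map $h\colon S\to B$ that preserves each of the operations $0,1,\neg,\oplus,*,\to,\vee,\wedge,\exists,\forall$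 whenever the arguments and the value of the operation all lie in $S$. \textbf{Theorem.} The class $\mathbb{MMV}_{\mathrm{FSI}}$ has the finite embeddability property, and so does the variety $\mathbb{MMV}$. -/

import Mathlib

universe u

/-- An MV-algebra `(A, ⊕, ¬, 0)`. -/
class MVAlgebra (A : Type u) where
  oplus : A → A → A
  neg : A → A
  zero : A
  oplus_assoc : ∀ x y z : A, oplus (oplus x y) z = oplus x (oplus y z)
  oplus_comm : ∀ x y : A, oplus x y = oplus y x
  oplus_zero : ∀ x : A, oplus x zero = x
  neg_neg : ∀ x : A, neg (neg x) = x
  oplus_neg_zero : ∀ x : A, oplus x (neg zero) = neg zero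
  luk : ∀ x y : A, oplus (neg (oplus (neg x) y)) y = oplus (neg (oplus (neg y) x)) x

namespace MVAlgebra

variable {A : Type u} [MVAlgebra A]

/-- The top element `1 = ¬0`. -/
def one : A := neg zero

/-- The product `x * y = ¬(¬x ⊕ ¬y)`. -/
def prod (x y : A) : A := neg (oplus (neg x) (neg y))

/-- The implication `x → y = ¬x ⊕ y`. -/
def imp (x y : A) : A := oplus (neg x) y

/-- The join `x ∨ y = (x → y) → y`. -/
def join (x y : A) : A := imp (imp x y) y

/-- The meet `x ∧ y = x * (x → y)`. -/
def meet (x y : A) : A := prod x (imp x y)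

end MVAlgebra

open MVAlgebra in
/-- A monadic MV-algebra: an MV-algebra with two unary operations `∃` (`ex`) and
`∀` (`all`) satisfying the identities (M1)-(M5). -/
class MonadicMVAlgebra (A : Type u) extends MVAlgebra A where
  ex : A → A
  all : A → A
  all_imp_self : ∀ x : A, imp (all x) x = one
  all_imp_all : ∀ x y : A, all (imp x (all y)) = imp (ex x) (all y)
  all_all_imp : ∀ x y : A, all (imp (all x) y) = imp (all x) (all y)
  all_ex_join : ∀ x y : A, all (join (ex x) y) = join (ex x) (all y)
  ex_prod_self : ∀ x : A, ex (prod x x) = prod (ex x) (ex x)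

namespace MonadicMVAlgebra

open MVAlgebra

/-- A congruence of a monadic MV-algebra: an equivalence relation compatible with the
fundamental operations (hence also with the derived ones). -/
structure Congruence (A : Type u) [MonadicMVAlgebra A] extends Setoid A where
  oplus_congr : ∀ {a b c d : A}, r a b → r c d → r (oplus a c) (oplus b d)
  neg_congr : ∀ {a b : A}, r a b → r (neg a) (neg b)
  ex_congr : ∀ {a b : A}, r a b → r (ex a) (ex b)
  all_congr : ∀ {a b : A}, r a b → r (all a) (all b)

/-- `A` is finitely subdirectly irreducible: the identity relation is finitely
meet-irreducible in the lattice of congruences of `A`. -/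
def IsFSI (A : Type u) [MonadicMVAlgebra A] : Prop :=
  ∀ θ ψ : Congruence A, θ.toSetoid ⊓ ψ.toSetoid = ⊥ → θ.toSetoid = ⊥ ∨ ψ.toSetoid = ⊥

/-- The restriction of `h` to `S` is an embedding into `B` of the partial algebra that `A`
induces on `S`: it is injective, and it preserves every operation (fundamental or derived)
whenever arguments and value of the operation all lie in `S`. The values of `h` outside `S`
play no role. -/
structure IsPartialEmbedding {A B : Type u} [MonadicMVAlgebra A] [MonadicMVAlgebra B]
    (S : Set A) (h : A → B) : Prop where
  injOn : Set.InjOn h S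
  map_zero : (zero : A) ∈ S → h zero = zero
  map_one : (one : A) ∈ S → h one = one
  map_neg : ∀ a ∈ S, neg a ∈ S → h (neg a) = neg (h a)
  map_oplus : ∀ a ∈ S, ∀ b ∈ S, oplus a b ∈ S → h (oplus a b) = oplus (h a) (h b)
  map_prod : ∀ a ∈ S, ∀ b ∈ S, prod a b ∈ S → h (prod a b) = prod (h a) (h b)
  map_imp : ∀ a ∈ S, ∀ b ∈ S, imp a b ∈ S → h (imp a b) = imp (h a) (h b)
  map_join : ∀ a ∈ S, ∀ b ∈ S, join a b ∈ S → h (join a b) = join (h a) (h b)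
  map_meet : ∀ a ∈ S, ∀ b ∈ S, meet a b ∈ S → h (meet a b) = meet (h a) (h b)
  map_ex : ∀ a ∈ S, ex a ∈ S → h (ex a) = ex (h a)
  map_all : ∀ a ∈ S, all a ∈ S → h (all a) = all (h a)

/-- A class `K` of monadic MV-algebras has the finite embeddability property: every finite
partial subalgebra of a member of `K` embeds into a finite member of `K`. -/
def HasFEP (K : ∀ (A : Type u) [MonadicMVAlgebra A], Prop) : Prop :=
  ∀ (A : Type u) [MonadicMVAlgebra A], K A → ∀ S : Set A, S.Finite →
    ∃ (B : Type u) (_ : MonadicMVAlgebra B),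
      Finite B ∧ K B ∧ ∃ h : A → B, IsPartialEmbedding S h

/-- The class of finitely subdirectly irreducible monadic MV-algebras. -/
def MMVFSI (A : Type u) [MonadicMVAlgebra A] : Prop := IsFSI A

/-- The class (variety) of all monadic MV-algebras. -/
def MMV (A : Type u) [MonadicMVAlgebra A] : Prop := True

end MonadicMVAlgebra

/-! Finite partial subalgebras are embedded into algebras of functions from a finite set to a finite
Łukasiewicz chain, with `∃` and `∀` computed as maximum and minimum.

Fix a prime filter `Q` of the algebra of constants of `A`. For every `s` there is a prime filter `P`
of `A` that meets the constants exactly in `Q` and contains `∃s → s` (`exists_witness`). Hence `A/P`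
is an MV-chain extending the chain of constants modulo `Q`, and `s` attains the value `∃s` there.
The identity `∃(x*x) = ∃x*∃x` is what makes this possible. Finitely many such chains, one for each
relevant `s`, turn the quantifiers into maxima and minima.

These chains embed into Chang's linearly ordered groups, which share the Chang group of the
constants as a common ordered subgroup. A Gordan-type alternative, applied to the amalgamated sum of
the groups, yields rational functionals that agree on this subgroup and are positive on any
prescribed finite set of positive elements (`exists_addMonoidHom_rat_amalgam`). Clearing
denominators gives values in `{0, …, n}` that respect all operations inside the given finite set
(`exists_funModel`).

The function algebras are simple, hence finitely subdirectly irreducible. If `A` is nontrivial and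
finitely subdirectly irreducible, then `{1}` is a prime filter of constants and a single model
separates the points. In general, finitely many filters `Q` separate them, and the product of the
corresponding models is used. -/

namespace MVAlgebra

local infixl:65 " +ₘ " => oplus
local infixl:70 " *ₘ " => prod
local infixr:60 " ⇨ₘ " => imp
local prefix:max "∼ₘ" => neg

/-! ### Arithmetic and natural order of MV-algebras -/

section Basic

variable {A : Type u} [MVAlgebra A]

/-- The natural order of an MV-algebra. -/
def le (x y : A) : Prop := x ⇨ₘ y = one

local infix:50 " ≤ₘ " => le

instance : Std.Associative (oplus : A → A → A) := ⟨oplus_assoc⟩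
instance : Std.Commutative (oplus : A → A → A) := ⟨oplus_comm⟩

theorem neg_zero : ∼ₘ(zero : A) = one := rfl

theorem neg_one : ∼ₘ(one : A) = zero := neg_neg _

theorem zero_oplus (x : A) : zero +ₘ x = x := by rw [oplus_comm, oplus_zero]

theorem oplus_one (x : A) : x +ₘ one = one := oplus_neg_zero x

theorem one_oplus (x : A) : one +ₘ x = one := by rw [oplus_comm, oplus_one]

theorem neg_oplus_self (x : A) : ∼ₘx +ₘ x = one := by
  have h := luk x (one : A)
  rw [oplus_one, neg_one, zero_oplus] at h
  exact h.symm

theorem oplus_neg_self (x : A) : x +ₘ ∼ₘx = one := by rw [oplus_comm, neg_oplus_self]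

theorem neg_prod (x y : A) : ∼ₘ(x *ₘ y) = ∼ₘx +ₘ ∼ₘy := neg_neg _

theorem neg_oplus (x y : A) : ∼ₘ(x +ₘ y) = ∼ₘx *ₘ ∼ₘy := by
  rw [prod, neg_neg, neg_neg]

theorem neg_imp (x y : A) : ∼ₘ(x ⇨ₘ y) = x *ₘ ∼ₘy := by rw [imp, neg_oplus, neg_neg]

theorem prod_comm (x y : A) : x *ₘ y = y *ₘ x := by rw [prod, oplus_comm]; rfl

theorem prod_assoc (x y z : A) : x *ₘ y *ₘ z = x *ₘ (y *ₘ z) := by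
  simp only [prod, neg_neg, oplus_assoc]

instance : Std.Associative (prod : A → A → A) := ⟨prod_assoc⟩
instance : Std.Commutative (prod : A → A → A) := ⟨prod_comm⟩

theorem prod_one (x : A) : x *ₘ one = x := by rw [prod, neg_one, oplus_zero, neg_neg]

theorem one_prod (x : A) : one *ₘ x = x := by rw [prod_comm, prod_one]

theorem prod_zero (x : A) : x *ₘ zero = zero := by
  rw [prod, neg_zero, oplus_one, neg_one]

theorem prod_neg_self (x : A) : x *ₘ ∼ₘx = zero := by
  rw [prod, neg_neg, neg_oplus_self, neg_one]

theorem imp_prod (x y z : A) : x *ₘ y ⇨ₘ z = x ⇨ₘ y ⇨ₘ z := by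
  simp only [imp, neg_prod, oplus_assoc]

theorem imp_left_comm (x y z : A) : x ⇨ₘ y ⇨ₘ z = y ⇨ₘ x ⇨ₘ z := by
  rw [← imp_prod, prod_comm, imp_prod]

theorem one_imp (x : A) : one ⇨ₘ x = x := by rw [imp, neg_one, zero_oplus]

theorem imp_one (x : A) : x ⇨ₘ one = one := oplus_one _

theorem imp_zero (x : A) : x ⇨ₘ zero = ∼ₘx := oplus_zero _

theorem imp_self (x : A) : x ⇨ₘ x = one := neg_oplus_self x

theorem neg_imp_neg (x y : A) : ∼ₘy ⇨ₘ ∼ₘx = x ⇨ₘ y := by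
  rw [imp, imp, neg_neg, oplus_comm]

theorem le_refl (x : A) : x ≤ₘ x := imp_self x

theorem le_one (x : A) : x ≤ₘ one := imp_one x

theorem zero_le (x : A) : zero ≤ₘ x := by rw [le, imp, neg_zero, one_oplus]

theorem join_comm (x y : A) : join x y = join y x := luk x y

theorem le_antisymm {x y : A} (h : x ≤ₘ y) (h' : y ≤ₘ x) : x = y := by
  have := join_comm x y
  rw [join, join, show x ⇨ₘ y = one from h, show y ⇨ₘ x = one from h', one_imp, one_imp] at this
  exact this.symm

theorem oplus_prod_neg_of_le {x y : A} (h : x ≤ₘ y) : x +ₘ y *ₘ ∼ₘx = y := by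
  have := join_comm x y
  rw [join, join, show x ⇨ₘ y = one from h, one_imp, imp, neg_imp, oplus_comm] at this
  exact this.symm

theorem le_oplus_right (x z : A) : x ≤ₘ x +ₘ z := by
  rw [le, imp, ← oplus_assoc, neg_oplus_self, one_oplus]

theorem le_oplus_left (x z : A) : x ≤ₘ z +ₘ x := by
  rw [oplus_comm]; exact le_oplus_right x z

theorem le_trans {x y z : A} (h : x ≤ₘ y) (h' : y ≤ₘ z) : x ≤ₘ z := by
  rw [← oplus_prod_neg_of_le h', ← oplus_prod_neg_of_le h, oplus_assoc]
  exact le_oplus_right _ _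

theorem eq_one_of_one_le {x : A} (h : one ≤ₘ x) : x = one := le_antisymm (le_one x) h

theorem eq_zero_of_le_zero {x : A} (h : x ≤ₘ zero) : x = zero := le_antisymm h (zero_le x)

theorem oplus_le_oplus_left {x y : A} (h : x ≤ₘ y) (z : A) : z +ₘ x ≤ₘ z +ₘ y := by
  rw [← oplus_prod_neg_of_le h, ← oplus_assoc]
  exact le_oplus_right _ _

theorem neg_le_neg {x y : A} (h : x ≤ₘ y) : ∼ₘy ≤ₘ ∼ₘx := by
  rw [le, neg_imp_neg]; exact h

theorem le_neg_of_prod_eq_zero {x y : A} (h : x *ₘ y = zero) : x ≤ₘ ∼ₘy := by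
  rw [le, imp, ← neg_prod, h, neg_zero]

theorem prod_eq_zero_of_le_neg {x y : A} (h : x ≤ₘ ∼ₘy) : x *ₘ y = zero := by
  rw [prod, show ∼ₘx +ₘ ∼ₘy = one from h, neg_one]

theorem oplus_eq_one_iff {x y : A} : x +ₘ y = one ↔ ∼ₘx ≤ₘ y := by
  rw [le, imp, neg_neg]

theorem prod_le_prod_left {x y : A} (h : x ≤ₘ y) (z : A) : z *ₘ x ≤ₘ z *ₘ y :=
  neg_le_neg (oplus_le_oplus_left (neg_le_neg h) _)

theorem prod_le_prod {x y z w : A} (h : x ≤ₘ y) (h' : z ≤ₘ w) : x *ₘ z ≤ₘ y *ₘ w := by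
  refine le_trans (prod_le_prod_left h' x) ?_
  rw [prod_comm x, prod_comm y]
  exact prod_le_prod_left h w

theorem prod_le_left (x y : A) : x *ₘ y ≤ₘ x := by
  have := prod_le_prod_left (le_one y) x
  rwa [prod_one] at this

theorem prod_le_iff {x y z : A} : x *ₘ y ≤ₘ z ↔ x ≤ₘ y ⇨ₘ z := by rw [le, le, imp_prod]

theorem imp_le_imp_left {x y : A} (h : x ≤ₘ y) (z : A) : z ⇨ₘ x ≤ₘ z ⇨ₘ y :=
  oplus_le_oplus_left h _

theorem imp_le_imp_right {x y : A} (h : x ≤ₘ y) (z : A) : y ⇨ₘ z ≤ₘ x ⇨ₘ z := by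
  rw [← neg_imp_neg y, ← neg_imp_neg x]
  exact imp_le_imp_left (neg_le_neg h) _

theorem prod_imp_le (x y : A) : x *ₘ (x ⇨ₘ y) ≤ₘ y := by
  rw [prod_comm, prod_le_iff]; exact le_refl _

theorem le_imp (x y : A) : y ≤ₘ x ⇨ₘ y := le_oplus_left _ _

theorem imp_trans (x y z : A) : x ⇨ₘ y ≤ₘ (y ⇨ₘ z) ⇨ₘ x ⇨ₘ z := by
  rw [← prod_le_iff, ← prod_le_iff]
  have h : (x ⇨ₘ y) *ₘ (y ⇨ₘ z) *ₘ x = x *ₘ (x ⇨ₘ y) *ₘ (y ⇨ₘ z) := by ac_rfl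
  rw [h]
  refine le_trans (prod_le_prod (prod_imp_le x y) (le_refl _)) (prod_imp_le y z)

theorem meet_comm (x y : A) : meet x y = meet y x := by
  have h := join_comm (∼ₘx) (∼ₘy)
  have key : ∀ a b : A, meet a b = ∼ₘ(join (∼ₘb) (∼ₘa)) := fun a b => by
    rw [join, neg_imp_neg, neg_imp, neg_neg, prod_comm]; rfl
  rw [key, key, h]

theorem meet_eq_left {x y : A} (h : x ≤ₘ y) : meet x y = x := by
  rw [meet, show x ⇨ₘ y = one from h, prod_one]

theorem meet_eq_right {x y : A} (h : y ≤ₘ x) : meet x y = y := by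
  rw [meet_comm, meet_eq_left h]

theorem join_eq_right {x y : A} (h : x ≤ₘ y) : join x y = y := by
  rw [join, show x ⇨ₘ y = one from h, one_imp]

theorem join_le {x y z : A} (hx : x ≤ₘ z) (hy : y ≤ₘ z) : join x y ≤ₘ z := by
  have h : join x y ≤ₘ join z y := imp_le_imp_right (imp_le_imp_right hx y) y
  rw [join_comm z y, join_eq_right hy] at h
  exact h

theorem join_imp_imp (x y : A) : join (x ⇨ₘ y) (y ⇨ₘ x) = one := by
  have hle : (x ⇨ₘ y) ⇨ₘ y ⇨ₘ x ≤ₘ y ⇨ₘ x := by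
    rw [imp_left_comm, ← prod_le_iff, prod_comm]
    have hx : x ≤ₘ (x ⇨ₘ y) ⇨ₘ x := le_imp _ _
    change meet y ((x ⇨ₘ y) ⇨ₘ x) ≤ₘ x
    rw [meet_comm]
    refine le_trans (prod_le_prod_left (imp_le_imp_right hx y) _) ?_
    rw [prod_comm]
    exact prod_imp_le _ _
  exact hle

theorem le_of_join_eq_one {a b r x : A} (h : join a b = one) (ha : a ≤ₘ r ⇨ₘ x)
    (hb : b ≤ₘ r ⇨ₘ x) : r ≤ₘ x := by
  have := join_le ha hb
  rw [h] at this
  exact eq_one_of_one_le this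

/-- Powers with respect to the product. -/
def mpow (a : A) : ℕ → A
  | 0 => one
  | n + 1 => a *ₘ mpow a n

theorem mpow_add (a : A) (m n : ℕ) : mpow a (m + n) = mpow a m *ₘ mpow a n := by
  induction m with
  | zero => rw [Nat.zero_add, mpow, one_prod]
  | succ k ih => rw [Nat.add_right_comm, mpow, ih, mpow, prod_assoc]

theorem mpow_le_mpow (a : A) {m n : ℕ} (h : m ≤ n) : mpow a n ≤ₘ mpow a m := by
  obtain ⟨k, rfl⟩ := Nat.exists_eq_add_of_le h
  rw [mpow_add]; exact prod_le_left _ _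

/-- The hypothesis says `(a → b) → b = 1`, so `a → b = b`. Iterating gives `aⁿ → b = b`. -/
theorem join_mpow_left {a b : A} (h : join a b = one) (n : ℕ) : join (mpow a n) b = one := by
  have hab : a ⇨ₘ b = b := le_antisymm h (le_imp _ _)
  have : ∀ k, mpow a k ⇨ₘ b = b := fun k => by
    induction k with
    | zero => rw [mpow, one_imp]
    | succ k ih => rw [mpow, imp_prod, ih, hab]
  rw [join, this, imp_self]

theorem join_mpow {a b : A} (h : join a b = one) (m n : ℕ) :
    join (mpow a m) (mpow b n) = one := by
  rw [join_comm]
  apply join_mpow_left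
  rw [join_comm]
  exact join_mpow_left h m

end Basic

/-! ### Filters, prime filters and quotients -/

section Filters

variable {A : Type u} [MVAlgebra A]

local infix:50 " ≤ₘ " => le

/-- Implicative filters of an MV-algebra. -/
structure IsFilter (F : Set A) : Prop where
  one_mem : one ∈ F
  mp : ∀ {x y : A}, x ∈ F → x ⇨ₘ y ∈ F → y ∈ F

/-- Prime filters. -/
structure IsPrimeFilter (F : Set A) : Prop extends IsFilter F where
  zero_notMem : zero ∉ F
  total : ∀ x y : A, x ⇨ₘ y ∈ F ∨ y ⇨ₘ x ∈ F

theorem IsFilter.mem_of_le {F : Set A} (hF : IsFilter F) {x y : A} (hx : x ∈ F) (h : x ≤ₘ y) :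
    y ∈ F := hF.mp hx (by rw [show x ⇨ₘ y = one from h]; exact hF.one_mem)

theorem IsFilter.prod_mem {F : Set A} (hF : IsFilter F) {x y : A} (hx : x ∈ F) (hy : y ∈ F) :
    x *ₘ y ∈ F :=
  hF.mp hy (hF.mem_of_le hx (prod_le_iff.1 (le_refl _)))

/-- The filter generated by a filter and an element. -/
def adjoin (F : Set A) (a : A) : Set A := {x | ∃ n, mpow a n ⇨ₘ x ∈ F}

theorem subset_adjoin {F : Set A} (hF : IsFilter F) (a : A) : F ⊆ adjoin F a :=
  fun _ hx => ⟨0, hF.mem_of_le hx (le_imp _ _)⟩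

theorem mem_adjoin_self {F : Set A} (hF : IsFilter F) (a : A) : a ∈ adjoin F a :=
  ⟨1, by rw [mpow, mpow, prod_one, imp_self]; exact hF.one_mem⟩

theorem isFilter_adjoin {F : Set A} (hF : IsFilter F) (a : A) : IsFilter (adjoin F a) where
  one_mem := subset_adjoin hF a hF.one_mem
  mp := by
    rintro x y ⟨n, hn⟩ ⟨m, hm⟩
    refine ⟨m + n, hF.mem_of_le (hF.prod_mem hm hn) ?_⟩
    rw [← prod_le_iff, mpow_add]
    have : (mpow a m ⇨ₘ x ⇨ₘ y) *ₘ (mpow a n ⇨ₘ x) *ₘ (mpow a m *ₘ mpow a n) =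
      (mpow a n *ₘ (mpow a n ⇨ₘ x)) *ₘ (mpow a m *ₘ (mpow a m ⇨ₘ x ⇨ₘ y)) := by ac_rfl
    rw [this]
    exact le_trans (prod_le_prod (prod_imp_le _ _) (prod_imp_le _ _)) (prod_imp_le _ _)

/-- Powers of `a` and `b` still join to `1`. Modulo `F`, `x` lies above a power of each, hence above
their join. -/
theorem mem_of_mem_adjoin_of_mem_adjoin {F : Set A} (hF : IsFilter F) {a b x : A}
    (h : join a b = one) (ha : x ∈ adjoin F a) (hb : x ∈ adjoin F b) : x ∈ F := by
  obtain ⟨m, hm⟩ := ha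
  obtain ⟨n, hn⟩ := hb
  refine hF.mem_of_le (hF.prod_mem hm hn) (le_of_join_eq_one (join_mpow h m n) ?_ ?_)
  · rw [← prod_le_iff, ← prod_assoc]
    exact le_trans (prod_le_left _ _) (prod_imp_le _ _)
  · rw [← prod_le_iff, prod_comm (_ ⇨ₘ _), ← prod_assoc]
    exact le_trans (prod_le_left _ _) (prod_imp_le _ _)

/-- The prime filter theorem: a filter can be separated from a disjoint nonempty set that is
directed modulo the filter. -/
theorem exists_isPrimeFilter {F D : Set A} (hF : IsFilter F) (hD : D.Nonempty)
    (hFD : Disjoint F D)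
    (hdir : ∀ c ∈ D, ∀ d ∈ D, ∃ e ∈ D, c ⇨ₘ e ∈ F ∧ d ⇨ₘ e ∈ F) :
    ∃ P : Set A, IsPrimeFilter P ∧ F ⊆ P ∧ Disjoint P D := by
  obtain ⟨P, hFP, hP⟩ := zorn_subset_nonempty {P : Set A | IsFilter P ∧ Disjoint P D}
    (by
      intro c hc hchain hne
      refine ⟨⋃₀ c, ⟨⟨?_, ?_⟩, ?_⟩, fun s hs => Set.subset_sUnion_of_mem hs⟩
      · obtain ⟨s, hs⟩ := hne
        exact ⟨s, hs, (hc hs).1.one_mem⟩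
      · rintro x y ⟨s, hs, hx⟩ ⟨t, ht, hy⟩
        rcases hchain.total hs ht with h | h
        · exact ⟨t, ht, (hc ht).1.mp (h hx) hy⟩
        · exact ⟨s, hs, (hc hs).1.mp hx (h hy)⟩
      · exact Set.disjoint_sUnion_left.2 fun s hs => (hc hs).2) F ⟨hF, hFD⟩
  obtain ⟨hPf, hPD⟩ := hP.prop
  have hmax : ∀ a, a ∉ P → ∃ d ∈ D, d ∈ adjoin P a := fun a ha => by
    by_contra! hcon
    have := hP.le_of_ge (y := adjoin P a) ⟨isFilter_adjoin hPf a,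
      Set.disjoint_left.2 fun x hx hxD => hcon x hxD hx⟩ (subset_adjoin hPf a)
    exact ha (this (mem_adjoin_self hPf a))
  refine ⟨P, ⟨hPf, fun h0 => ?_, fun x y => ?_⟩, hFP, hPD⟩
  · obtain ⟨d, hd⟩ := hD
    exact Set.disjoint_left.1 hPD (hPf.mem_of_le h0 (zero_le d)) hd
  -- If both implications were missing, adjoining either one would reach `D`. By directedness both
  -- adjunctions contain a common `e ∈ D`, and prelinearity puts `e` into `P`.
  · by_contra! hcon
    obtain ⟨c, hc, hc'⟩ := hmax _ hcon.1
    obtain ⟨d, hd, hd'⟩ := hmax _ hcon.2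
    obtain ⟨e, he, hce, hde⟩ := hdir c hc d hd
    refine Set.disjoint_left.1 hPD (mem_of_mem_adjoin_of_mem_adjoin hPf (join_imp_imp x y)
      ((isFilter_adjoin hPf _).mp hc' (subset_adjoin hPf _ (hFP hce)))
      ((isFilter_adjoin hPf _).mp hd' (subset_adjoin hPf _ (hFP hde)))) he

/-- The congruence of a filter. -/
def filterSetoid {F : Set A} (hF : IsFilter F) : Setoid A where
  r x y := x ⇨ₘ y ∈ F ∧ y ⇨ₘ x ∈ F
  iseqv :=
    { refl := fun x => by rw [imp_self]; exact ⟨hF.one_mem, hF.one_mem⟩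
      symm := fun h => ⟨h.2, h.1⟩
      trans := fun {x y z} h h' =>
        ⟨hF.mp h'.1 (hF.mem_of_le h.1 (imp_trans x y z)),
          hF.mp h.2 (hF.mem_of_le h'.2 (imp_trans z y x))⟩ }

theorem imp_le_oplus_imp_oplus (a b z : A) : a ⇨ₘ b ≤ₘ z +ₘ a ⇨ₘ z +ₘ b := by
  have h := imp_trans (∼ₘz) a b
  rw [imp_left_comm] at h
  have h2 : a ⇨ₘ b ≤ₘ (∼ₘz ⇨ₘ a) ⇨ₘ ∼ₘz ⇨ₘ b := by
    rw [le, imp_left_comm]; exact imp_trans _ _ _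
  simpa only [imp, neg_neg] using h2

theorem filterSetoid_oplus {F : Set A} (hF : IsFilter F) {a b c d : A}
    (h : filterSetoid hF a b) (h' : filterSetoid hF c d) :
    filterSetoid hF (a +ₘ c) (b +ₘ d) := by
  have key : ∀ {a b : A} (z : A), filterSetoid hF a b → filterSetoid hF (z +ₘ a) (z +ₘ b) :=
    fun z h => ⟨hF.mem_of_le h.1 (imp_le_oplus_imp_oplus _ _ z),
      hF.mem_of_le h.2 (imp_le_oplus_imp_oplus _ _ z)⟩
  refine (filterSetoid hF).trans ?_ (key b h')
  rw [oplus_comm a, oplus_comm b]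
  exact key c h

theorem filterSetoid_neg {F : Set A} (hF : IsFilter F) {a b : A} (h : filterSetoid hF a b) :
    filterSetoid hF (∼ₘa) (∼ₘb) :=
  ⟨by rw [neg_imp_neg]; exact h.2, by rw [neg_imp_neg]; exact h.1⟩

/-- The quotient of an MV-algebra by a filter. -/
def FilterQuotient {F : Set A} (hF : IsFilter F) : Type u := Quotient (filterSetoid hF)

namespace FilterQuotient

variable {F : Set A} (hF : IsFilter F)

/-- The canonical projection. -/
def mk (a : A) : FilterQuotient hF := Quotient.mk (filterSetoid hF) a

instance : MVAlgebra (FilterQuotient hF) where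
  oplus := Quotient.map₂ oplus fun _ _ h _ _ h' => filterSetoid_oplus hF h h'
  neg := Quotient.map neg fun _ _ h => filterSetoid_neg hF h
  zero := mk hF zero
  oplus_assoc := by
    rintro ⟨x⟩ ⟨y⟩ ⟨z⟩; exact congrArg (mk hF) (oplus_assoc x y z)
  oplus_comm := by
    rintro ⟨x⟩ ⟨y⟩; exact congrArg (mk hF) (oplus_comm x y)
  oplus_zero := by
    rintro ⟨x⟩; exact congrArg (mk hF) (oplus_zero x)
  neg_neg := by
    rintro ⟨x⟩; exact congrArg (mk hF) (neg_neg x)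
  oplus_neg_zero := by
    rintro ⟨x⟩; exact congrArg (mk hF) (oplus_neg_zero x)
  luk := by
    rintro ⟨x⟩ ⟨y⟩; exact congrArg (mk hF) (luk x y)

theorem mk_surjective : Function.Surjective (mk hF) := Quotient.mk_surjective

theorem mk_eq_mk {a b : A} : mk hF a = mk hF b ↔ a ⇨ₘ b ∈ F ∧ b ⇨ₘ a ∈ F :=
  Quotient.eq (r := filterSetoid hF)

theorem mk_eq_one {a : A} : mk hF a = one ↔ a ∈ F := by
  change mk hF a = mk hF one ↔ _
  rw [mk_eq_mk, imp_one, one_imp]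
  exact ⟨fun h => h.2, fun h => ⟨hF.one_mem, h⟩⟩

end FilterQuotient

/-- Homomorphisms of MV-algebras. -/
structure IsMVHom {A B : Type u} [MVAlgebra A] [MVAlgebra B] (f : A → B) : Prop where
  map_zero : f zero = zero
  map_neg : ∀ a, f (∼ₘa) = ∼ₘ(f a)
  map_oplus : ∀ a b, f (a +ₘ b) = f a +ₘ f b

namespace IsMVHom

variable {A B : Type u} [MVAlgebra A] [MVAlgebra B] {f : A → B}

theorem map_one (hf : IsMVHom f) : f one = one := by rw [one, hf.map_neg, hf.map_zero]; rfl

theorem map_prod (hf : IsMVHom f) (a b : A) : f (a *ₘ b) = f a *ₘ f b := by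
  simp only [prod, hf.map_neg, hf.map_oplus]

theorem map_imp (hf : IsMVHom f) (a b : A) : f (a ⇨ₘ b) = f a ⇨ₘ f b := by
  simp only [imp, hf.map_neg, hf.map_oplus]

end IsMVHom

theorem FilterQuotient.isMVHom_mk {F : Set A} (hF : IsFilter F) : IsMVHom (mk hF) :=
  ⟨rfl, fun _ => rfl, fun _ _ => rfl⟩

/-- Nontrivial totally ordered MV-algebras. -/
class IsChain (V : Type u) [MVAlgebra V] : Prop where
  zero_ne_one : (zero : V) ≠ one
  total : ∀ x y : V, x ≤ₘ y ∨ y ≤ₘ x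

theorem FilterQuotient.isChain {F : Set A} (hF : IsPrimeFilter F) :
    IsChain (FilterQuotient hF.toIsFilter) where
  zero_ne_one h := hF.zero_notMem ((mk_eq_one hF.toIsFilter).1 h)
  total x y := by
    obtain ⟨x, rfl⟩ := mk_surjective _ x
    obtain ⟨y, rfl⟩ := mk_surjective _ y
    rw [le, le, ← (isMVHom_mk _).map_imp, ← (isMVHom_mk _).map_imp, mk_eq_one, mk_eq_one]
    exact hF.total x y

end Filters

end MVAlgebra

namespace MVAlgebra

local infixl:65 " +ₘ " => oplus
local infixl:70 " *ₘ " => prod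
local infixr:60 " ⇨ₘ " => imp
local prefix:max "∼ₘ" => neg
local infix:50 " ≤ₘ " => le

/-! ### Chang's ordered group of an MV-chain -/

section Chain

variable {V : Type u} [MVAlgebra V]

theorem ne_one_of_le {x y : V} (h : x ≤ₘ y) (hy : y ≠ one) : x ≠ one := by
  rintro rfl; exact hy (eq_one_of_one_le h)

theorem prod_ne_one {x y : V} (hx : x ≠ one) : x *ₘ y ≠ one := ne_one_of_le (prod_le_left x y) hx

/-- Both `x` and `z` lie above `¬y`, so each is `¬y` plus its product with `y`. Both sides become
`¬y ⊕ x*y ⊕ y*z`. This is associativity in the Chang group when both pairs carry. -/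
theorem oplus_prod_assoc {x y z : V} (hxy : x +ₘ y = one) (hyz : y +ₘ z = one) :
    x *ₘ y +ₘ z = x +ₘ y *ₘ z := by
  have h1 : ∼ₘy +ₘ x *ₘ y = x := by
    have := oplus_prod_neg_of_le (x := ∼ₘy) (y := x)
      (oplus_eq_one_iff.1 (by rw [oplus_comm]; exact hxy))
    rwa [neg_neg] at this
  have h2 : ∼ₘy +ₘ z *ₘ y = z := by
    have := oplus_prod_neg_of_le (x := ∼ₘy) (y := z) (oplus_eq_one_iff.1 hyz)
    rwa [neg_neg] at this
  calc x *ₘ y +ₘ z = x *ₘ y +ₘ (∼ₘy +ₘ z *ₘ y) := by rw [h2]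
    _ = ∼ₘy +ₘ x *ₘ y +ₘ z *ₘ y := by ac_rfl
    _ = x +ₘ y *ₘ z := by rw [h1, prod_comm]

theorem prod_oplus_assoc {x y z : V} (hxy : x *ₘ y = zero) (hyz : y *ₘ z = zero) :
    (x +ₘ y) *ₘ z = x *ₘ (y +ₘ z) := by
  have h1 : ∼ₘy *ₘ (x +ₘ y) = x := by
    have := meet_eq_right (le_neg_of_prod_eq_zero hxy)
    rwa [meet, imp, neg_neg, oplus_comm] at this
  have h2 : ∼ₘy *ₘ (z +ₘ y) = z := by
    rw [prod_comm] at hyz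
    have := meet_eq_right (le_neg_of_prod_eq_zero hyz)
    rwa [meet, imp, neg_neg, oplus_comm] at this
  calc (x +ₘ y) *ₘ z = (x +ₘ y) *ₘ (∼ₘy *ₘ (z +ₘ y)) := by rw [h2]
    _ = ∼ₘy *ₘ (x +ₘ y) *ₘ (z +ₘ y) := by ac_rfl
    _ = x *ₘ (y +ₘ z) := by rw [h1, oplus_comm z]

/-- The elements of Chang's ordered group of an MV-chain. -/
@[ext]
structure Chang (V : Type u) [MVAlgebra V] where
  int : ℤ
  frac : V
  frac_ne_one : frac ≠ one

namespace Chang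

/-- The pair `(m, x)` stands for `m + x`, with `1` excluded as a fractional part so that
representations are unique. When `x ⊕ y = 1` there is a carry, and the remainder `x + y - 1` is `x *
y`. -/
noncomputable instance : Add (Chang V) where
  add a b := open Classical in
    if h : a.frac +ₘ b.frac = one then
      ⟨a.int + b.int + 1, a.frac *ₘ b.frac, prod_ne_one a.frac_ne_one⟩
    else ⟨a.int + b.int, a.frac +ₘ b.frac, h⟩

theorem add_of_eq {a b : Chang V} (h : a.frac +ₘ b.frac = one) :
    a + b = ⟨a.int + b.int + 1, a.frac *ₘ b.frac, prod_ne_one a.frac_ne_one⟩ := dif_pos h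

theorem add_of_ne {a b : Chang V} (h : a.frac +ₘ b.frac ≠ one) :
    a + b = ⟨a.int + b.int, a.frac +ₘ b.frac, h⟩ := dif_neg h

protected theorem add_comm (a b : Chang V) : a + b = b + a := by
  by_cases h : a.frac +ₘ b.frac = one
  · have h' := h
    rw [oplus_comm] at h'
    rw [add_of_eq h, add_of_eq h']
    ext
    · simp only; ring
    · exact prod_comm _ _
  · have h' := h
    rw [oplus_comm] at h'
    rw [add_of_ne h, add_of_ne h']
    ext
    · simp only; ring
    · exact oplus_comm _ _

end Chang

variable [IsChain V]

theorem prod_eq_zero_of_oplus_ne_one {x y : V} (h : x +ₘ y ≠ one) : x *ₘ y = zero := by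
  rcases IsChain.total (∼ₘx) y with h' | h'
  · exact absurd (oplus_eq_one_iff.2 h') h
  · rw [prod_comm]; exact prod_eq_zero_of_le_neg h'

/-- By totality `x ⊕ y*z ≤ z`, since otherwise adding `¬z` would give `x ⊕ y = 1`. So the right side
is its own meet with `z`, which simplifies to the left side. -/
theorem oplus_prod_of_mixed {x y z : V} (hxy : x +ₘ y ≠ one) (hyz : y +ₘ z = one) :
    (x +ₘ y) *ₘ z = x +ₘ y *ₘ z := by
  have hw : y *ₘ z +ₘ ∼ₘz = y := by
    have := oplus_prod_neg_of_le (x := ∼ₘz) (y := y)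
      (oplus_eq_one_iff.1 (by rw [oplus_comm]; exact hyz))
    rwa [neg_neg, oplus_comm] at this
  have hle : x +ₘ y *ₘ z ≤ₘ z := by
    refine (IsChain.total _ _).resolve_right fun h => hxy ?_
    rw [← hw, ← oplus_assoc, oplus_comm]
    exact h
  have := meet_eq_right hle
  rw [meet, imp, oplus_comm, oplus_assoc, hw, prod_comm] at this
  exact this

namespace Chang

/-- Elements of an MV-chain as elements of its Chang group. -/
noncomputable def ofInt (n : ℤ) (x : V) : Chang V :=
  open Classical in if h : x = one then ⟨n + 1, zero, IsChain.zero_ne_one⟩ else ⟨n, x, h⟩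

theorem ofInt_one (n : ℤ) : ofInt n (one : V) = ⟨n + 1, zero, IsChain.zero_ne_one⟩ := dif_pos rfl

theorem ofInt_of_ne {x : V} (n : ℤ) (h : x ≠ one) : ofInt n x = ⟨n, x, h⟩ := dif_neg h

instance : Zero (Chang V) := ⟨⟨0, zero, IsChain.zero_ne_one⟩⟩

noncomputable instance : Neg (Chang V) where
  neg a := open Classical in
    if h : a.frac = zero then ⟨-a.int, zero, IsChain.zero_ne_one⟩
    else ⟨-a.int - 1, ∼ₘa.frac, fun h' => h (by rw [← neg_neg a.frac, h', neg_one])⟩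

theorem add_assoc_of_ne {a b c : Chang V} (hab : a.frac +ₘ b.frac ≠ one) :
    a + b + c = a + (b + c) := by
  have hab0 := prod_eq_zero_of_oplus_ne_one hab
  rw [add_of_ne hab]
  by_cases hbc : b.frac +ₘ c.frac = one
  · have hm := oplus_prod_of_mixed hab hbc
    rw [add_of_eq hbc]
    have h1 : a.frac +ₘ b.frac +ₘ c.frac = one := by rw [oplus_assoc, hbc, oplus_one]
    have h2 : a.frac +ₘ b.frac *ₘ c.frac ≠ one :=
      ne_one_of_le (oplus_le_oplus_left (prod_le_left _ _) _) hab
    rw [add_of_eq (by exact h1), add_of_ne (by exact h2)]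
    ext
    · simp only; ring
    · exact hm
  · have hbc0 := prod_eq_zero_of_oplus_ne_one hbc
    rw [add_of_ne hbc]
    by_cases h : a.frac +ₘ b.frac +ₘ c.frac = one
    · rw [add_of_eq (by exact h), add_of_eq (by rw [oplus_assoc] at h; exact h)]
      ext
      · simp only; ring
      · exact prod_oplus_assoc hab0 hbc0
    · rw [add_of_ne (by exact h), add_of_ne (by rw [oplus_assoc] at h; exact h)]
      ext
      · simp only; ring
      · exact oplus_assoc _ _ _

protected theorem add_assoc (a b c : Chang V) : a + b + c = a + (b + c) := by
  by_cases hab : a.frac +ₘ b.frac = one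
  · by_cases hbc : b.frac +ₘ c.frac = one
    · have hm := oplus_prod_assoc hab hbc
      rw [add_of_eq hab, add_of_eq hbc]
      by_cases h : a.frac *ₘ b.frac +ₘ c.frac = one
      · rw [add_of_eq (by exact h), add_of_eq (by rw [hm] at h; exact h)]
        ext
        · simp only; ring
        · exact prod_assoc _ _ _
      · rw [add_of_ne (by exact h), add_of_ne (by rw [hm] at h; exact h)]
        ext
        · simp only; ring
        · exact hm
    -- Reversing the order of the summands reduces to the case where the first pair does not carry.
    · rw [Chang.add_comm a, Chang.add_comm (b + a), Chang.add_comm b c, Chang.add_comm a]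
      rw [oplus_comm] at hbc
      exact (add_assoc_of_ne hbc).symm
  · exact add_assoc_of_ne hab

protected theorem zero_add (a : Chang V) : 0 + a = a := by
  have h : (0 : Chang V).frac +ₘ a.frac = a.frac := zero_oplus _
  have h' : (0 : Chang V).frac +ₘ a.frac ≠ one := by rw [h]; exact a.frac_ne_one
  rw [add_of_ne h']
  ext
  · exact zero_add _
  · exact h

theorem neg_of_eq {a : Chang V} (h : a.frac = zero) :
    -a = ⟨-a.int, zero, IsChain.zero_ne_one⟩ := dif_pos h

theorem neg_of_ne {a : Chang V} (h : a.frac ≠ zero) :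
    -a = ⟨-a.int - 1, ∼ₘa.frac, fun h' => h (by rw [← neg_neg a.frac, h', neg_one])⟩ := dif_neg h

protected theorem neg_add_cancel (a : Chang V) : -a + a = 0 := by
  by_cases h : a.frac = zero
  · rw [neg_of_eq h]
    have h' : zero +ₘ a.frac ≠ one := by rw [zero_oplus]; exact a.frac_ne_one
    rw [add_of_ne (by exact h')]
    ext
    · exact neg_add_cancel _
    · exact (zero_oplus _).trans h
  · rw [neg_of_ne h, add_of_eq (by exact neg_oplus_self _)]
    ext
    · change -a.int - 1 + a.int + 1 = 0; ring
    · exact (prod_comm _ _).trans (prod_neg_self _)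

noncomputable instance : AddCommGroup (Chang V) where
  add_assoc := Chang.add_assoc
  add_comm := Chang.add_comm
  zero_add := Chang.zero_add
  add_zero a := by rw [Chang.add_comm, Chang.zero_add]
  neg_add_cancel := Chang.neg_add_cancel
  nsmul := nsmulRec
  zsmul := zsmulRec

/-- The positive cone of the Chang group. -/
noncomputable def cone (V : Type u) [MVAlgebra V] [IsChain V] : AddGroupCone (Chang V) where
  carrier := {a | 0 ≤ a.int}
  zero_mem' := show (0 : ℤ) ≤ 0 from Int.le_refl 0
  add_mem' := by
    intro a b (ha : 0 ≤ a.int) (hb : 0 ≤ b.int)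
    change 0 ≤ (a + b).int
    by_cases h : a.frac +ₘ b.frac = one
    · rw [add_of_eq h]; change 0 ≤ a.int + b.int + 1; omega
    · rw [add_of_ne h]; change 0 ≤ a.int + b.int; omega
  eq_zero_of_mem_of_neg_mem' := by
    intro a (ha : 0 ≤ a.int) (hb : 0 ≤ (-a).int)
    by_cases h : a.frac = zero
    · rw [neg_of_eq h] at hb
      change 0 ≤ -a.int at hb
      ext
      · change a.int = 0; omega
      · exact h
    · rw [neg_of_ne h] at hb
      change 0 ≤ -a.int - 1 at hb
      omega

theorem mem_cone {a : Chang V} : a ∈ cone V ↔ 0 ≤ a.int := Iff.rfl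

instance : HasMemOrNegMem (cone V) where
  mem_or_neg_mem a := by
    rw [mem_cone, mem_cone]
    by_cases h : a.frac = zero
    · rw [neg_of_eq h]; change _ ∨ 0 ≤ -a.int; omega
    · rw [neg_of_ne h]; change _ ∨ 0 ≤ -a.int - 1; omega

noncomputable instance : LinearOrder (Chang V) :=
  open Classical in LinearOrder.mkOfAddGroupCone (cone V)

instance : IsOrderedAddMonoid (Chang V) := IsOrderedAddMonoid.mkOfCone (cone V)

theorem nonneg_iff {a : Chang V} : 0 ≤ a ↔ 0 ≤ a.int := by
  change a - 0 ∈ cone V ↔ _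
  rw [sub_zero]; rfl

/-- The embedding of an MV-chain into its Chang group. -/
noncomputable def emb (x : V) : Chang V := ofInt 0 x

theorem emb_zero : emb (zero : V) = 0 := ofInt_of_ne 0 IsChain.zero_ne_one

theorem emb_nonneg (x : V) : 0 ≤ emb x := by
  rw [nonneg_iff, emb]
  by_cases h : x = one
  · rw [h, ofInt_one]; exact zero_le_one
  · rw [ofInt_of_ne _ h]

theorem emb_eq_zero_iff {x : V} : emb x = 0 ↔ x = zero := by
  refine ⟨fun h => ?_, fun h => h ▸ emb_zero⟩
  by_cases hx : x = one
  · rw [emb, hx, ofInt_one] at h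
    exact absurd (congrArg Chang.int h) one_ne_zero
  · rw [emb, ofInt_of_ne _ hx] at h
    exact congrArg Chang.frac h

theorem emb_pos {x : V} (h : x ≠ zero) : 0 < emb x :=
  lt_of_le_of_ne (emb_nonneg x) fun h' => h (emb_eq_zero_iff.1 h'.symm)

/-- Truncated addition and product are `min(1, x+y)` and `max(0, x+y-1)`. This additive form
survives every group homomorphism, even one that is not monotone. -/
theorem emb_oplus_add_emb_prod (x y : V) : emb (x +ₘ y) + emb (x *ₘ y) = emb x + emb y := by
  by_cases hx : x = one
  · rw [hx, one_oplus, one_prod]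
  by_cases hy : y = one
  · rw [hy, oplus_one, prod_one, add_comm]
  have e : emb x + emb y = ⟨0, x, hx⟩ + ⟨0, y, hy⟩ := by
    rw [emb, emb, ofInt_of_ne _ hx, ofInt_of_ne _ hy]
  rw [e]
  by_cases h : x +ₘ y = one
  · have hp : x *ₘ y ≠ one := prod_ne_one hx
    have e2 : emb (one : V) + emb (x *ₘ y) = ⟨1, zero, IsChain.zero_ne_one⟩ + ⟨0, x *ₘ y, hp⟩ := by
      rw [emb, emb, ofInt_one, ofInt_of_ne _ hp]; rfl
    have h0 : zero +ₘ x *ₘ y ≠ one := by rw [zero_oplus]; exact hp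
    rw [add_of_eq (a := ⟨0, x, hx⟩) (b := ⟨0, y, hy⟩) h, h, e2, add_of_ne (by exact h0)]
    ext
    · rfl
    · exact zero_oplus _
  · rw [prod_eq_zero_of_oplus_ne_one h, emb_zero, add_zero, emb, ofInt_of_ne _ h,
      add_of_ne (by exact h)]
    rfl

section Map

variable {W : Type u} [MVAlgebra W] [IsChain W] {f : V → W}

/-- Functoriality of the Chang group for injective homomorphisms. -/
noncomputable def map (f : V → W) (hf : IsMVHom f) (hinj : Function.Injective f) : Chang V →+ Chang W where
  toFun a := ⟨a.int, f a.frac, fun h => a.frac_ne_one (hinj (h.trans hf.map_one.symm))⟩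
  map_zero' := by ext <;> [rfl; exact hf.map_zero]
  map_add' a b := by
    by_cases h : a.frac +ₘ b.frac = one
    · rw [add_of_eq h, add_of_eq (by simp only; rw [← hf.map_oplus, h, hf.map_one])]
      ext
      · rfl
      · exact hf.map_prod _ _
    · have h' : f a.frac +ₘ f b.frac ≠ one := by
        rw [← hf.map_oplus, ← hf.map_one]; exact fun h' => h (hinj h')
      rw [add_of_ne h, add_of_ne (by exact h')]
      ext
      · rfl
      · exact hf.map_oplus _ _

theorem map_nonneg_iff (hf : IsMVHom f) (hinj : Function.Injective f) {a : Chang V} :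
    0 ≤ map f hf hinj a ↔ 0 ≤ a := by
  rw [nonneg_iff, nonneg_iff]; rfl

theorem map_emb (hf : IsMVHom f) (hinj : Function.Injective f) (x : V) :
    map f hf hinj (emb x) = emb (f x) := by
  by_cases h : x = one
  · rw [h, hf.map_one, emb, emb, ofInt_one, ofInt_one]
    ext
    · rfl
    · exact hf.map_zero
  · have h' : f x ≠ one := fun h' => h (hinj (h'.trans hf.map_one.symm))
    rw [emb, emb, ofInt_of_ne _ h, ofInt_of_ne _ h']
    rfl

end Map

end Chang

end Chain

end MVAlgebra

/-! ### Rational functionals positive on finite sets -/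

section OrderedGroups

/-- An element of infinite order of an abelian group is mapped to `1` by some homomorphism to
the rationals. -/
theorem exists_addMonoidHom_rat_eq_one {H : Type u} [AddCommGroup H] {v : H}
    (hv : ∀ n : ℤ, n • v = 0 → n = 0) : ∃ χ : H →+ ℚ, χ v = 1 := by
  have hinj : Function.Injective (zmultiplesHom H v) := by
    rw [injective_iff_map_eq_zero]
    exact fun n hn => hv n (by simpa using hn)
  obtain ⟨χ, hχ⟩ := (Module.Baer.of_divisible ℚ).extension_property_addMonoidHom
    (zmultiplesHom H v) hinj (Int.castAddHom ℚ)
  refine ⟨χ, ?_⟩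
  have := DFunLike.congr_fun hχ 1
  simpa using this

/-- A form of Gordan's theorem for abelian groups. -/
theorem exists_addMonoidHom_rat_pos {κ : Type u} (s : Finset κ) :
    ∀ {H : Type u} [AddCommGroup H] (v : κ → H),
      (∀ n : κ → ℕ, ∑ k ∈ s, n k • v k = 0 → ∀ k ∈ s, n k = 0) →
      ∃ φ : H →+ ℚ, ∀ k ∈ s, 0 < φ (v k) := by
  classical
  induction s using Finset.induction_on with
  | empty => exact fun v _ => ⟨0, by simp⟩
  | insert a s ha ih =>
    intro H _ v hv
    have hsum : ∀ (m : ℕ) (n : κ → ℕ), m • v a + ∑ k ∈ s, n k • v k = 0 →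
        m = 0 ∧ ∀ k ∈ s, n k = 0 := fun m n h => by
      have hne : ∀ k ∈ s, k ≠ a := fun k hk => by rintro rfl; exact ha hk
      have := hv (Function.update n a m) (by
        rw [Finset.sum_insert ha, Function.update_self, ← h]
        congr 1
        exact Finset.sum_congr rfl fun k hk => by rw [Function.update_of_ne (hne k hk)])
      refine ⟨by simpa using this a (Finset.mem_insert_self _ _), fun k hk => ?_⟩
      have := this k (Finset.mem_insert_of_mem hk)
      rwa [Function.update_of_ne (hne k hk)] at this
    obtain ⟨φ, hφ⟩ := ih v fun n h => (hsum 0 n (by simpa using h)).2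
    rcases lt_or_ge 0 (φ (v a)) with hpos | hneg
    · exact ⟨φ, fun k hk => by
        rcases Finset.mem_insert.1 hk with rfl | hk
        exacts [hpos, hφ k hk]⟩
    -- If `φ` is not positive on `v a`, that element is factored out. A new relation `∑ n k • v k =
    -- m • v a` with `m ≤ 0` is an old one. For `m > 0`, applying `φ` makes the left side
    -- nonnegative and the right side nonpositive, so every coefficient vanishes.
    obtain ⟨ψ, hψ⟩ := ih (fun k => (QuotientAddGroup.mk (v k) : H ⧸ AddSubgroup.zmultiples (v a)))
      fun n h => by
        have hmem : ∑ k ∈ s, n k • v k ∈ AddSubgroup.zmultiples (v a) := by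
          rw [← QuotientAddGroup.eq_zero_iff, ← QuotientAddGroup.mk'_apply, map_sum, ← h]
          simp
        obtain ⟨m, hm⟩ := AddSubgroup.mem_zmultiples_iff.1 hmem
        rcases le_or_gt m 0 with hm0 | hm0
        · refine (hsum m.natAbs n ?_).2
          rw [← hm, ← natCast_zsmul, ← add_zsmul, show (m.natAbs : ℤ) + m = 0 by omega, zero_zsmul]
        · have h1 : ∑ k ∈ s, (n k : ℚ) * φ (v k) = m * φ (v a) := by
            have := congrArg φ hm
            rw [map_zsmul, map_sum] at this
            simpa using this.symm
          have h2 : ∑ k ∈ s, (n k : ℚ) * φ (v k) = 0 := by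
            refine le_antisymm ?_ (Finset.sum_nonneg fun k hk =>
              mul_nonneg (Nat.cast_nonneg _) (hφ k hk).le)
            rw [h1]
            exact mul_nonpos_of_nonneg_of_nonpos (by exact_mod_cast hm0.le) hneg
          intro k hk
          have := (Finset.sum_eq_zero_iff_of_nonneg fun k hk =>
            mul_nonneg (Nat.cast_nonneg _) (hφ k hk).le).1 h2 k hk
          rcases mul_eq_zero.1 this with h | h
          · exact_mod_cast h
          · exact absurd h (hφ k hk).ne'
    obtain ⟨χ, hχ⟩ := exists_addMonoidHom_rat_eq_one (v := v a) fun n hn => by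
      have := (hsum n.natAbs 0 (by
        rcases Int.natAbs_eq n with h | h
        · rw [h, natCast_zsmul] at hn; simpa using hn
        · rw [h, neg_zsmul, natCast_zsmul, neg_eq_zero] at hn; simpa using hn)).1
      omega
    -- The functional sought is `N ψ + χ`: it is `1` at `v a`, where `ψ` vanishes, and a large `N`
    -- lets `ψ` dominate on `s`.
    obtain ⟨N, hN⟩ : ∃ N : ℕ, ∀ k ∈ s, 0 < N * ψ (QuotientAddGroup.mk (v k)) + χ (v k) := by
      have h1 : ∀ k ∈ s, ∀ᶠ N : ℕ in Filter.atTop,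
          0 < N * ψ (QuotientAddGroup.mk (v k)) + χ (v k) := fun k hk => by
        have := (tendsto_natCast_atTop_atTop (R := ℚ)).atTop_mul_const (hψ k hk)
        filter_upwards [this.eventually_gt_atTop (-χ (v k))] with N hN
        linarith
      exact ((Filter.eventually_all_finset s).2 h1).exists
    refine ⟨N • ψ.comp (QuotientAddGroup.mk' _) + χ, fun k hk => ?_⟩
    rcases Finset.mem_insert.1 hk with rfl | hk
    · have h0 : (QuotientAddGroup.mk (v k) : H ⧸ AddSubgroup.zmultiples (v k)) = 0 :=
        (QuotientAddGroup.eq_zero_iff _).2 (AddSubgroup.mem_zmultiples _)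
      simp [h0, hχ]
    · simpa using hN k hk

/-- Finitely many positive elements of linearly ordered groups with a common ordered subgroup can
be made positive by rational functionals that agree on the subgroup. -/
theorem exists_addMonoidHom_rat_amalgam {X D : Type u} [Fintype X] [AddCommGroup D]
    [LinearOrder D] [IsOrderedAddMonoid D] {G : X → Type u} [∀ i, AddCommGroup (G i)]
    [∀ i, LinearOrder (G i)] [∀ i, IsOrderedAddMonoid (G i)] (J : ∀ i, D →+ G i)
    (hJ : ∀ i d, 0 ≤ J i d ↔ 0 ≤ d) (s : Finset (Σ i, G i)) (hs : ∀ k ∈ s, 0 < k.2) :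
    ∃ φ : ∀ i, G i →+ ℚ, (∀ i j d, φ i (J i d) = φ j (J j d)) ∧ ∀ k ∈ s, 0 < φ k.1 k.2 := by
  classical
  -- The quotient by `N` is the sum of the `G i` amalgamated over `D`, so functionals on it are
  -- families of functionals agreeing on `D`.
  let N : AddSubgroup (∀ i, G i) :=
    { carrier := {g | ∃ d : X → D, ∑ i, d i = 0 ∧ ∀ i, g i = J i (d i)}
      zero_mem' := ⟨0, by simp, by simp⟩
      add_mem' := by
        rintro a b ⟨d, hd, had⟩ ⟨e, he, hbe⟩
        exact ⟨d + e, by simp [Finset.sum_add_distrib, hd, he], fun i => by simp [had, hbe]⟩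
      neg_mem' := by
        rintro a ⟨d, hd, had⟩
        exact ⟨-d, by simp [hd], fun i => by simp [had]⟩ }
  obtain ⟨φ, hφ⟩ := exists_addMonoidHom_rat_pos s
    (H := (∀ i, G i) ⧸ N) (fun k => QuotientAddGroup.mk (Pi.single k.1 k.2)) (by
      intro n hn
      have hmem : ∑ k ∈ s, n k • (Pi.single k.1 k.2 : ∀ i, G i) ∈ N := by
        rw [← QuotientAddGroup.eq_zero_iff, ← QuotientAddGroup.mk'_apply, map_sum, ← hn]
        simp
      obtain ⟨d, hd, hdJ⟩ := hmem
      have hterm : ∀ i, ∀ k ∈ s, 0 ≤ n k • (Pi.single k.1 k.2 : ∀ i, G i) i := fun i k hk => by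
        refine nsmul_nonneg ?_ _
        have : (0 : ∀ i, G i) ≤ Pi.single k.1 k.2 := Pi.single_nonneg.2 (hs k hk).le
        exact this i
      simp only [Finset.sum_apply, Pi.smul_apply] at hdJ
      -- A nonnegative combination lying in `N` has nonnegative components `d i` with sum zero. They
      -- all vanish, and then so does each summand.
      have hd0 : ∀ i, 0 ≤ d i := fun i => by
        rw [← hJ i, ← hdJ i]
        exact Finset.sum_nonneg (hterm i)
      have hdz : ∀ i, d i = 0 := fun i =>
        (Finset.sum_eq_zero_iff_of_nonneg fun i _ => hd0 i).1 hd i (Finset.mem_univ i)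
      intro k hk
      have h1 := hdJ k.1
      rw [hdz, map_zero] at h1
      have h2 := (Finset.sum_eq_zero_iff_of_nonneg (hterm k.1)).1 h1 k hk
      rw [Pi.single_eq_same] at h2
      exact (nsmul_eq_zero_iff_left (hs k hk).ne').1 h2)
  refine ⟨fun i => (φ.comp (QuotientAddGroup.mk' N)).comp (AddMonoidHom.single G i), ?_, hφ⟩
  intro i j d
  have : (QuotientAddGroup.mk (Pi.single i (J i d)) : (∀ i, G i) ⧸ N) =
      QuotientAddGroup.mk (Pi.single j (J j d)) := by
    rw [← sub_eq_zero, ← QuotientAddGroup.mk_sub, QuotientAddGroup.eq_zero_iff]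
    refine ⟨Pi.single i d - Pi.single j d, ?_, fun k => ?_⟩
    · simp [Finset.sum_sub_distrib]
    · rw [Pi.sub_apply, Pi.sub_apply, map_sub]
      congr 1
      · exact (Pi.apply_single (fun k => J k) (fun k => map_zero _) i d k).symm
      · exact (Pi.apply_single (fun k => J k) (fun k => map_zero _) j d k).symm
  exact congrArg φ this

end OrderedGroups

namespace MonadicMVAlgebra

open MVAlgebra

local infixl:65 " +ₘ " => oplus
local infixl:70 " *ₘ " => prod
local infixr:60 " ⇨ₘ " => imp
local prefix:max "∼ₘ" => neg
local infix:50 " ≤ₘ " => le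

/-! ### Quantifiers, constants and witnessing prime filters -/

section Basic

variable {A : Type u} [MonadicMVAlgebra A]

theorem all_le (x : A) : all x ≤ₘ x := all_imp_self x

theorem all_one : all (one : A) = one := by
  have := all_all_imp (one : A) one
  rwa [all_imp_self, MVAlgebra.imp_self] at this

theorem all_zero : all (zero : A) = zero := eq_zero_of_le_zero (all_le _)

theorem all_neg (x : A) : all (∼ₘx) = ∼ₘ(ex x) := by
  have := all_imp_all x zero
  rwa [all_zero, imp_zero, imp_zero] at this

theorem ex_eq (x : A) : ex x = ∼ₘ(all (∼ₘx)) := by rw [all_neg, MVAlgebra.neg_neg]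

theorem ex_neg (x : A) : ex (∼ₘx) = ∼ₘ(all x) := by rw [ex_eq, MVAlgebra.neg_neg]

theorem le_ex (x : A) : x ≤ₘ ex x := by
  have := neg_le_neg (all_le (∼ₘx))
  rwa [MVAlgebra.neg_neg, ← ex_eq] at this

theorem ex_one : ex (one : A) = one := eq_one_of_one_le (le_ex _)

theorem all_all (x : A) : all (all x) = all x := by
  have := all_imp_all one x
  rwa [ex_one, one_imp] at this

theorem ex_all (x : A) : ex (all x) = all x := by
  refine le_antisymm ?_ (le_ex _)
  have := all_imp_all (all x) x
  rw [MVAlgebra.imp_self, all_one] at this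
  exact this.symm

theorem all_ex (x : A) : all (ex x) = ex x := by rw [ex_eq, all_neg, ex_all]

theorem all_le_all {x y : A} (h : x ≤ₘ y) : all x ≤ₘ all y := by
  have := all_all_imp x y
  rw [show all x ⇨ₘ y = one from le_trans (all_le x) h, all_one] at this
  exact this.symm

theorem ex_le_ex {x y : A} (h : x ≤ₘ y) : ex x ≤ₘ ex y := by
  rw [ex_eq x, ex_eq y]
  exact neg_le_neg (all_le_all (neg_le_neg h))

theorem all_imp_le (x y : A) : all (x ⇨ₘ y) ≤ₘ all x ⇨ₘ all y := by
  rw [← all_all_imp]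
  exact all_le_all (imp_le_imp_right (all_le x) y)

theorem all_eq_self_iff {c : A} : all c = c ↔ ex c = c :=
  ⟨fun h => by rw [← h, ex_all], fun h => by rw [← h, all_ex]⟩

theorem all_oplus_of_const {c d : A} (hc : all c = c) (hd : all d = d) :
    all (c +ₘ d) = c +ₘ d := by
  have h : all (∼ₘc) = ∼ₘc := by rw [all_neg, all_eq_self_iff.1 hc]
  have := all_all_imp (∼ₘc) d
  rwa [h, hd, imp, MVAlgebra.neg_neg] at this

theorem all_neg_of_const {c : A} (hc : all c = c) : all (∼ₘc) = ∼ₘc := by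
  rw [all_neg, all_eq_self_iff.1 hc]

theorem all_prod_of_const {c d : A} (hc : all c = c) (hd : all d = d) :
    all (c *ₘ d) = c *ₘ d :=
  all_neg_of_const (all_oplus_of_const (all_neg_of_const hc) (all_neg_of_const hd))

theorem all_mpow_of_const {c : A} (hc : all c = c) (n : ℕ) : all (mpow c n) = mpow c n := by
  induction n with
  | zero => exact all_one
  | succ k ih => exact all_prod_of_const hc ih

/-- Since `¬c ∨ z = c → c*z`, the fourth identity evaluates `∀(c → c*y)` as `c → c*∀y`, while the
third gives `c → ∀(c*y)`. Multiplying by `c` cancels the implications, as both conclusions lie below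
`c`. -/
theorem all_const_prod {c : A} (hc : all c = c) (y : A) : all (c *ₘ y) = c *ₘ all y := by
  have hc' := all_eq_self_iff.1 (all_neg_of_const hc)
  have hj : ∀ z : A, join (∼ₘc) z = c ⇨ₘ c *ₘ z := fun z => by
    rw [join_comm, join, imp, neg_imp, MVAlgebra.neg_neg, oplus_comm, prod_comm]; rfl
  have h := all_ex_join (∼ₘc) y
  have h2 := all_all_imp c (c *ₘ y)
  rw [hc', hj, hj] at h
  rw [hc, h] at h2
  have h3 := congrArg (fun t => c *ₘ t) h2
  change meet c (c *ₘ all y) = meet c (all (c *ₘ y)) at h3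
  rw [meet_eq_right (prod_le_left _ _), meet_eq_right (le_trans (all_le _) (prod_le_left _ _))]
    at h3
  exact h3.symm

theorem ex_ex_imp_self (s : A) : ex (ex s ⇨ₘ s) = one := by
  rw [ex_eq, neg_imp, all_const_prod (all_ex s), all_neg, ← neg_imp, MVAlgebra.imp_self, MVAlgebra.neg_neg]

/-- The identity `∃(x*x) = ∃x*∃x` settles exponents `2^k`. The others follow from `u^(2^n) ≤ u^n`.
-/
theorem ex_mpow {u : A} (hu : ex u = one) (n : ℕ) : ex (mpow u n) = one := by
  have h : ∀ k, ex (mpow u (2 ^ k)) = one := fun k => by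
    induction k with
    | zero => rw [pow_zero, show mpow u 1 = u from prod_one u, hu]
    | succ k ih => rw [pow_succ, mul_two, mpow_add, ex_prod_self, ih, prod_one]
  refine eq_one_of_one_le ?_
  have := ex_le_ex (mpow_le_mpow u (Nat.lt_two_pow_self (n := n)).le)
  rwa [h] at this

/-- The subalgebra of constants of a monadic MV-algebra. -/
def Constants (A : Type u) [MonadicMVAlgebra A] : Type u := {c : A // all c = c}

namespace Constants

instance : MVAlgebra (Constants A) where
  oplus c d := ⟨c.1 +ₘ d.1, all_oplus_of_const c.2 d.2⟩
  neg c := ⟨∼ₘc.1, all_neg_of_const c.2⟩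
  zero := ⟨zero, all_zero⟩
  oplus_assoc _ _ _ := Subtype.ext (oplus_assoc _ _ _)
  oplus_comm _ _ := Subtype.ext (oplus_comm _ _)
  oplus_zero _ := Subtype.ext (oplus_zero _)
  neg_neg _ := Subtype.ext (MVAlgebra.neg_neg _)
  oplus_neg_zero _ := Subtype.ext (oplus_neg_zero _)
  luk _ _ := Subtype.ext (luk _ _)

/-- The universal quantifier with values in the constants. -/
def ofAll (x : A) : Constants A := ⟨all x, all_all x⟩

/-- The existential quantifier with values in the constants. -/
def ofEx (x : A) : Constants A := ⟨ex x, all_ex x⟩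

theorem isMVHom_val : IsMVHom (fun c : Constants A => c.1) :=
  ⟨rfl, fun _ => rfl, fun _ _ => rfl⟩

theorem le_iff {c d : Constants A} : c ≤ₘ d ↔ c.1 ≤ₘ d.1 := Subtype.ext_iff

theorem ofAll_val (c : Constants A) : ofAll c.1 = c := Subtype.ext c.2

end Constants

open Constants

/-- The filter of a monadic MV-algebra generated by a filter of constants. -/
theorem isFilter_ofAll_preimage {Q : Set (Constants A)} (hQ : IsFilter Q) :
    IsFilter (ofAll ⁻¹' Q) where
  one_mem := hQ.mem_of_le hQ.one_mem (le_iff.2 (by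
    change one ≤ₘ all one; rw [all_one]; exact le_refl _))
  mp {x y} hx hxy := hQ.mp hx (hQ.mem_of_le hxy (le_iff.2 (all_imp_le x y)))

/-- Put `u = ∃s → s`. For a constant `c`, `∀(uⁿ → c) = ∃(uⁿ) → c = c`, because `∃(uⁿ) = 1`. So
adjoining `u` to the filter generated by `Q` adds no new constants. The constants outside `Q` are
directed modulo this filter because `Q` is prime, and the prime filter theorem applies. -/
theorem exists_witness {Q : Set (Constants A)} (hQ : IsPrimeFilter Q) (s : A) :
    ∃ P : Set A, IsPrimeFilter P ∧ (∀ c : Constants A, c.1 ∈ P ↔ c ∈ Q) ∧ ex s ⇨ₘ s ∈ P := by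
  have hF0 := isFilter_ofAll_preimage hQ.toIsFilter
  have hmem : ∀ c : Constants A, c ∈ Q → c.1 ∈ adjoin (ofAll ⁻¹' Q) (ex s ⇨ₘ s) := fun c hc =>
    subset_adjoin hF0 _ (by rw [Set.mem_preimage, ofAll_val]; exact hc)
  obtain ⟨P, hP, hFP, hPD⟩ := exists_isPrimeFilter (F := adjoin (ofAll ⁻¹' Q) (ex s ⇨ₘ s))
    (D := {x | ∃ c : Constants A, c ∉ Q ∧ c.1 = x}) (isFilter_adjoin hF0 _) ⟨_, zero, hQ.zero_notMem, rfl⟩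
    (by
      rw [Set.disjoint_left]
      rintro x ⟨n, hn⟩ ⟨c, hc, rfl⟩
      refine hc ?_
      have h := all_imp_all (mpow (ex s ⇨ₘ s) n) c.1
      rw [c.2, ex_mpow (ex_ex_imp_self s), one_imp] at h
      have h' : ofAll (mpow (ex s ⇨ₘ s) n ⇨ₘ c.1) = c := Subtype.ext h
      rw [Set.mem_preimage, h'] at hn
      exact hn)
    (by
      rintro _ ⟨c, hc, rfl⟩ _ ⟨d, hd, rfl⟩
      have h1 : ∀ c : Constants A, c.1 ⇨ₘ c.1 ∈ adjoin (ofAll ⁻¹' Q) (ex s ⇨ₘ s) := fun c => by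
        rw [MVAlgebra.imp_self]; exact (isFilter_adjoin hF0 _).one_mem
      rcases hQ.total c d with h | h
      · exact ⟨_, ⟨d, hd, rfl⟩, hmem _ h, h1 d⟩
      · exact ⟨_, ⟨c, hc, rfl⟩, h1 c, hmem _ h⟩)
  refine ⟨P, hP, fun c => ⟨fun h => ?_, fun h => hFP (hmem c h)⟩, hFP (mem_adjoin_self hF0 _)⟩
  by_contra hc
  exact Set.disjoint_left.1 hPD h ⟨c, hc, rfl⟩

end Basic

/-! ### Constants of a finitely subdirectly irreducible algebra -/

section FSI

variable {A : Type u} [MonadicMVAlgebra A]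

/-- The congruence of a filter that is closed under the universal quantifier. -/
def filterCongruence {F : Set A} (hF : IsFilter F) (hall : ∀ x ∈ F, all x ∈ F) :
    Congruence A where
  toSetoid := filterSetoid hF
  oplus_congr := filterSetoid_oplus hF
  neg_congr := filterSetoid_neg hF
  all_congr h := ⟨hF.mem_of_le (hall _ h.1) (all_imp_le _ _),
    hF.mem_of_le (hall _ h.2) (all_imp_le _ _)⟩
  ex_congr {a b} h := by
    rw [ex_eq a, ex_eq b]
    have h := filterSetoid_neg hF h
    exact filterSetoid_neg hF ⟨hF.mem_of_le (hall _ h.1) (all_imp_le _ _),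
      hF.mem_of_le (hall _ h.2) (all_imp_le _ _)⟩

theorem isFilter_singleton_one (A : Type u) [MVAlgebra A] : IsFilter ({one} : Set A) where
  one_mem := rfl
  mp {x y} hx hxy := by
    rw [Set.mem_singleton_iff] at *
    rw [hx, one_imp] at hxy
    exact hxy

theorem all_mem_adjoin {c : A} (hc : all c = c) {x : A} (hx : x ∈ adjoin {one} c) :
    all x ∈ adjoin {one} c := by
  obtain ⟨n, hn⟩ := hx
  refine ⟨n, ?_⟩
  have h : mpow c n ≤ₘ x := hn
  have := all_le_all h
  rwa [all_mpow_of_const hc] at this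

/-- A filter generated by a constant is closed under `∀`, so it yields a congruence. Those generated
by `c → d` and `d → c` meet trivially by prelinearity, so one of them is the identity. -/
theorem isPrimeFilter_singleton_one (hA : IsFSI A) (h01 : (zero : A) ≠ one) :
    IsPrimeFilter ({one} : Set (Constants A)) where
  toIsFilter := isFilter_singleton_one _
  zero_notMem h := h01 (congrArg Subtype.val h)
  total c d := by
    have h1 := isFilter_singleton_one A
    let θ : Constants A → Congruence A := fun c =>
      filterCongruence (isFilter_adjoin h1 c.1) fun _ hx => all_mem_adjoin c.2 hx
    have hθ : ∀ c, (θ c).toSetoid = ⊥ → c = one := fun c h => by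
      have : (θ c).toSetoid c.1 one := by
        refine ⟨?_, ?_⟩
        · rw [imp_one]; exact (isFilter_adjoin h1 _).one_mem
        · rw [one_imp]; exact mem_adjoin_self h1 _
      rw [h] at this
      exact Subtype.ext this
    rcases hA (θ (c ⇨ₘ d)) (θ (d ⇨ₘ c)) (by
      refine le_bot_iff.1 fun x y hxy => ?_
      obtain ⟨hx, hy⟩ := Setoid.inf_iff_and.1 hxy
      have hj := join_imp_imp c.1 d.1
      exact le_antisymm (mem_of_mem_adjoin_of_mem_adjoin h1 hj hx.1 hy.1)
        (mem_of_mem_adjoin_of_mem_adjoin h1 hj hx.2 hy.2)) with h | h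
    · exact Or.inl (hθ _ h)
    · exact Or.inr (hθ _ h)

end FSI

end MonadicMVAlgebra

namespace MonadicMVAlgebra

open MVAlgebra

/-! ### Finite function models, products and local homomorphisms -/

section Models

/-- The functions from a set to the `n + 1` element Łukasiewicz chain. -/
@[ext]
structure FunModel (X : Type u) (n : ℕ) : Type u where
  val : X → ℕ
  val_le : ∀ i, val i ≤ n

namespace FunModel

variable {X : Type u} {n : ℕ}

instance : MVAlgebra (FunModel X n) where
  oplus f g := ⟨fun i => min n (f.val i + g.val i), fun _ => min_le_left _ _⟩
  neg f := ⟨fun i => n - f.val i, fun _ => Nat.sub_le _ _⟩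
  zero := ⟨fun _ => 0, fun _ => Nat.zero_le _⟩
  oplus_assoc f g h := by ext i; simp only; omega
  oplus_comm f g := by ext i; simp only; omega
  oplus_zero f := by ext i; have := f.val_le i; simp only; omega
  neg_neg f := by ext i; have := f.val_le i; simp only; omega
  oplus_neg_zero f := by ext i; simp only; omega
  luk f g := by
    ext i; have := f.val_le i; have := g.val_le i; simp only; omega

theorem oplus_val (f g : FunModel X n) (i : X) :
    (oplus f g).val i = min n (f.val i + g.val i) := rfl

theorem neg_val (f : FunModel X n) (i : X) : (neg f).val i = n - f.val i := rfl

theorem one_val (i : X) : (one : FunModel X n).val i = n := rfl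

theorem imp_val (f g : FunModel X n) (i : X) :
    (imp f g).val i = min n (n - f.val i + g.val i) := rfl

theorem prod_val (f g : FunModel X n) (i : X) :
    (prod f g).val i = f.val i + g.val i - n := by
  have := f.val_le i
  have := g.val_le i
  simp only [prod, neg_val, oplus_val]
  omega

theorem join_val (f g : FunModel X n) (i : X) :
    (join f g).val i = max (f.val i) (g.val i) := by
  have := f.val_le i
  have := g.val_le i
  simp only [join, imp_val]
  omega

instance [Finite X] : Finite (FunModel X n) :=
  have : Finite (Set.Iic n) := Set.finite_Iic n
  Finite.of_injective (fun f i => (⟨f.val i, f.val_le i⟩ : Set.Iic n)) fun f g h => by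
    ext i
    exact congrArg Subtype.val (congrFun h i)

variable [Fintype X]

/-- The supremum of a function, as a constant function. -/
def sup (f : FunModel X n) : FunModel X n :=
  ⟨fun _ => Finset.univ.sup f.val, fun _ => Finset.sup_le fun i _ => f.val_le i⟩

theorem le_sup (f : FunModel X n) (i j : X) : f.val i ≤ (sup f).val j :=
  Finset.le_sup (Finset.mem_univ i)

theorem exists_eq_sup (f : FunModel X n) (j : X) : ∃ i, (sup f).val j = f.val i := by
  obtain ⟨i, -, hi⟩ := Finset.exists_mem_eq_sup Finset.univ ⟨j, Finset.mem_univ j⟩ f.val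
  exact ⟨i, hi⟩

/-- The infimum of a function, as a constant function. -/
def inf (f : FunModel X n) : FunModel X n := neg (sup (neg f))

theorem inf_le (f : FunModel X n) (i j : X) : (inf f).val j ≤ f.val i := by
  have h := le_sup (neg f) i j
  have := f.val_le i
  rw [neg_val] at h
  rw [inf, neg_val]
  omega

theorem exists_eq_inf (f : FunModel X n) (j : X) : ∃ i, (inf f).val j = f.val i := by
  obtain ⟨i, hi⟩ := exists_eq_sup (neg f) j
  refine ⟨i, ?_⟩
  have := f.val_le i
  rw [neg_val] at hi
  rw [inf, neg_val]
  omega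

theorem sup_const (f : FunModel X n) (i j : X) : (sup f).val i = (sup f).val j := rfl

theorem inf_const (f : FunModel X n) (i j : X) : (inf f).val i = (inf f).val j := rfl

instance : MonadicMVAlgebra (FunModel X n) where
  ex := sup
  all := inf
  all_imp_self f := by
    ext i; rw [imp_val, one_val]
    have := inf_le f i i
    omega
  all_imp_all f g := by
    ext i; rw [imp_val]
    obtain ⟨j, hj⟩ := exists_eq_inf (imp f (inf g)) i
    obtain ⟨k, hk⟩ := exists_eq_sup f i
    have h1 := inf_le (imp f (inf g)) k i
    have h2 := le_sup f j i
    rw [imp_val, inf_const g _ i] at hj h1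
    omega
  all_all_imp f g := by
    ext i; rw [imp_val]
    obtain ⟨j, hj⟩ := exists_eq_inf (imp (inf f) g) i
    obtain ⟨k, hk⟩ := exists_eq_inf g i
    have h1 := inf_le (imp (inf f) g) k i
    have h2 := inf_le g j i
    rw [imp_val, inf_const f _ i] at hj h1
    omega
  all_ex_join f g := by
    ext i; rw [join_val]
    obtain ⟨j, hj⟩ := exists_eq_inf (join (sup f) g) i
    obtain ⟨k, hk⟩ := exists_eq_inf g i
    have h1 := inf_le (join (sup f) g) k i
    have h2 := inf_le g j i
    rw [join_val, sup_const f _ i] at hj h1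
    omega
  ex_prod_self f := by
    ext i; rw [prod_val]
    obtain ⟨j, hj⟩ := exists_eq_sup (prod f f) i
    obtain ⟨k, hk⟩ := exists_eq_sup f i
    have h1 := le_sup (prod f f) k i
    have h2 := le_sup f j i
    rw [prod_val] at hj h1
    omega

theorem ex_eq_sup (f : FunModel X n) : ex f = sup f := rfl

theorem all_eq_inf (f : FunModel X n) : all f = inf f := rfl

/-- If `a` and `b` are related and `a < b` at some point, then `b * ¬a` is related to `0` and
nonzero there. Applying `∃` makes it positive everywhere, and its `n`-fold sum is `1`. -/
theorem congruence_eq_top (θ : Congruence (FunModel X n)) (hθ : θ.toSetoid ≠ ⊥) :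
    θ.toSetoid = ⊤ := by
  obtain ⟨a, b, i, hab, hi⟩ : ∃ a b, ∃ i, θ.r a b ∧ a.val i < b.val i := by
    by_contra! hcon
    refine hθ (le_bot_iff.1 fun a b hab => ?_)
    refine FunModel.ext (funext fun i => _root_.le_antisymm ?_ ?_)
    · exact hcon b a i (θ.symm hab)
    · exact hcon a b i hab
  have hd : θ.r (neg (oplus (neg b) a)) zero := by
    have := θ.neg_congr (θ.oplus_congr (θ.neg_congr (θ.symm hab)) (θ.refl a))
    rwa [MVAlgebra.neg_oplus_self, MVAlgebra.neg_one] at this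
  have hex : (ex (zero : FunModel X n)) = zero := by
    ext j
    obtain ⟨k, hk⟩ := exists_eq_sup (zero : FunModel X n) j
    exact hk
  have he := θ.ex_congr hd
  rw [hex] at he
  have hpos : ∀ j, 0 < (ex (neg (oplus (neg b) a))).val j := fun j => by
    have h1 := le_sup (neg (oplus (neg b) a)) i j
    have h2 := b.val_le i
    rw [neg_val, oplus_val, neg_val] at h1
    rw [ex_eq_sup]
    omega
  have hsum : ∀ m : ℕ, ∃ y : FunModel X n, θ.r y zero ∧ ∀ j, min n m ≤ y.val j := fun m => by
    induction m with
    | zero => exact ⟨zero, θ.refl _, fun j => by simp⟩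
    | succ m ih =>
      obtain ⟨y, hy, hym⟩ := ih
      refine ⟨oplus y (ex (neg (oplus (neg b) a))), ?_, fun j => ?_⟩
      · have := θ.oplus_congr hy he
        rwa [oplus_zero] at this
      · rw [oplus_val]
        have := hpos j
        have := hym j
        omega
  have h1 : θ.r one zero := by
    obtain ⟨y, hy, hyn⟩ := hsum n
    have : y = one := by
      ext j
      have := hyn j
      have := y.val_le j
      rw [one_val]
      omega
    rwa [this] at hy
  have hall : ∀ x, θ.r x one := fun x => by
    have := θ.oplus_congr (θ.refl x) (θ.symm h1)
    rwa [oplus_zero, oplus_one] at this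
  exact top_le_iff.1 fun x y _ => θ.trans (hall x) (θ.symm (hall y))

theorem isFSI (X : Type u) [Fintype X] (n : ℕ) : IsFSI (FunModel X n) := by
  intro θ ψ h
  by_contra! hcon
  rw [congruence_eq_top θ hcon.1, congruence_eq_top ψ hcon.2, inf_top_eq] at h
  exact hcon.1 ((congruence_eq_top θ hcon.1).trans h)

end FunModel

section Pi

variable {I : Type u} {B : I → Type u} [∀ i, MonadicMVAlgebra (B i)]

instance : MonadicMVAlgebra (∀ i, B i) where
  oplus f g := fun i => oplus (f i) (g i)
  neg f := fun i => neg (f i)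
  zero := fun _ => zero
  oplus_assoc _ _ _ := funext fun _ => oplus_assoc _ _ _
  oplus_comm _ _ := funext fun _ => oplus_comm _ _
  oplus_zero _ := funext fun _ => oplus_zero _
  neg_neg _ := funext fun _ => neg_neg _
  oplus_neg_zero _ := funext fun _ => oplus_neg_zero _
  luk _ _ := funext fun _ => luk _ _
  ex f := fun i => ex (f i)
  all f := fun i => all (f i)
  all_imp_self _ := funext fun _ => all_imp_self _
  all_imp_all _ _ := funext fun _ => all_imp_all _ _
  all_all_imp _ _ := funext fun _ => all_all_imp _ _
  all_ex_join _ _ := funext fun _ => all_ex_join _ _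
  ex_prod_self _ := funext fun _ => ex_prod_self _

end Pi

section LocalHom

/-- Maps that preserve the fundamental operations within a set. -/
structure IsLocalHom {A B : Type u} [MonadicMVAlgebra A] [MonadicMVAlgebra B]
    (S : Set A) (h : A → B) : Prop where
  map_zero : (zero : A) ∈ S → h zero = zero
  map_neg : ∀ a ∈ S, neg a ∈ S → h (neg a) = neg (h a)
  map_oplus : ∀ a ∈ S, ∀ b ∈ S, oplus a b ∈ S → h (oplus a b) = oplus (h a) (h b)
  map_ex : ∀ a ∈ S, ex a ∈ S → h (ex a) = ex (h a)
  map_all : ∀ a ∈ S, all a ∈ S → h (all a) = all (h a)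

/-- A set together with the values of the MV-operations on it. -/
def step {A : Type u} [MVAlgebra A] (S : Set A) : Set A :=
  insert zero (S ∪ neg '' S ∪ Set.image2 oplus S S)

section Step

variable {A : Type u} [MVAlgebra A] {S : Set A}

theorem finite_step (hS : S.Finite) : (step S).Finite :=
  ((hS.union (hS.image _)).union (hS.image2 _ hS)).insert _

theorem subset_step : S ⊆ step S := fun _ h => Or.inr (Or.inl (Or.inl h))

theorem zero_mem_step : zero ∈ step S := Or.inl rfl

theorem neg_mem_step {a : A} (h : a ∈ S) : neg a ∈ step S :=
  Or.inr (Or.inl (Or.inr ⟨a, h, rfl⟩))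

theorem oplus_mem_step {a b : A} (ha : a ∈ S) (hb : b ∈ S) : oplus a b ∈ step S :=
  Or.inr (Or.inr ⟨a, ha, b, hb, rfl⟩)

end Step

variable {A B : Type u} [MonadicMVAlgebra A] [MonadicMVAlgebra B]

/-- Five closure steps suffice because `meet`, written with `⊕` and `¬`, is a term of depth five,
and the other derived operations are shallower. -/
theorem IsLocalHom.isPartialEmbedding {S : Set A} {h : A → B}
    (hh : IsLocalHom (step (step (step (step (step S))))) h)
    (hinj : Set.InjOn h S) : IsPartialEmbedding S h := by
  have hn : ∀ a ∈ step (step (step (step S))), h (neg a) = neg (h a) := fun a ha =>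
    hh.map_neg a (subset_step ha) (neg_mem_step ha)
  have ho : ∀ a ∈ step (step (step (step S))), ∀ b ∈ step (step (step (step S))),
      h (oplus a b) = oplus (h a) (h b) := fun a ha b hb =>
    hh.map_oplus a (subset_step ha) b (subset_step hb) (oplus_mem_step ha hb)
  have s1 : ∀ {a : A}, a ∈ step S → a ∈ step (step (step (step S))) := fun h =>
    subset_step (subset_step (subset_step h))
  have s0 : ∀ {a : A}, a ∈ S → a ∈ step (step (step (step S))) := fun h => s1 (subset_step h)
  have hprod : ∀ a ∈ step (step S), ∀ b ∈ step (step S), h (prod a b) = prod (h a) (h b) := by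
    intro a ha b hb
    have ha' := subset_step (subset_step ha)
    have hb' := subset_step (subset_step hb)
    have h1 := neg_mem_step ha
    have h2 := neg_mem_step hb
    rw [prod, hn _ (oplus_mem_step h1 h2), ho _ (subset_step h1) _ (subset_step h2), hn _ ha',
      hn _ hb']
    rfl
  have himp : ∀ a ∈ step (step S), ∀ b ∈ step (step S), h (imp a b) = imp (h a) (h b) := by
    intro a ha b hb
    rw [imp, ho _ (subset_step (neg_mem_step ha)) _ (subset_step (subset_step hb)),
      hn _ (subset_step (subset_step ha))]
    rfl
  have hmem : ∀ a ∈ S, ∀ b ∈ S, imp a b ∈ step (step S) := fun a ha b hb =>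
    oplus_mem_step (neg_mem_step ha) (subset_step hb)
  have s2 : ∀ {a : A}, a ∈ S → a ∈ step (step S) := fun h => subset_step (subset_step h)
  have hz : h zero = zero := hh.map_zero zero_mem_step
  exact
    { injOn := hinj
      map_zero := fun _ => hz
      map_one := fun _ => by
        rw [one, hn _ zero_mem_step, hz]; rfl
      map_neg := fun a ha _ => hn a (s0 ha)
      map_oplus := fun a ha b hb _ => ho a (s0 ha) b (s0 hb)
      map_prod := fun a ha b hb _ => hprod a (s2 ha) b (s2 hb)
      map_imp := fun a ha b hb _ => himp a (s2 ha) b (s2 hb)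
      map_join := fun a ha b hb _ => by
        rw [join, himp _ (hmem a ha b hb) _ (s2 hb), himp a (s2 ha) b (s2 hb)]; rfl
      map_meet := fun a ha b hb _ => by
        rw [meet, hprod a (s2 ha) _ (hmem a ha b hb), himp a (s2 ha) b (s2 hb)]; rfl
      map_ex := fun a ha ha' => hh.map_ex a (subset_step (s0 ha)) (subset_step (s0 ha'))
      map_all := fun a ha ha' => hh.map_all a (subset_step (s0 ha)) (subset_step (s0 ha')) }

end LocalHom

end Models

end MonadicMVAlgebra

/-! ### Embeddings between quotients -/

namespace MVAlgebra

local infixl:65 " +ₘ " => oplus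
local infixl:70 " *ₘ " => prod
local infixr:60 " ⇨ₘ " => imp
local prefix:max "∼ₘ" => neg
local infix:50 " ≤ₘ " => le

namespace FilterQuotient

variable {A B : Type u} [MVAlgebra A] [MVAlgebra B] {F : Set A} {P : Set B} {f : A → B}

/-- The map of quotients induced by a homomorphism. -/
def map (f : A → B) (hf : IsMVHom f) (hF : IsFilter F) (hP : IsFilter P)
    (h : ∀ a, f a ∈ P ↔ a ∈ F) : FilterQuotient hF → FilterQuotient hP :=
  Quotient.map f fun a b hab => by
    have hab : a ⇨ₘ b ∈ F ∧ b ⇨ₘ a ∈ F := hab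
    rw [← h, ← h, hf.map_imp, hf.map_imp] at hab
    exact hab

theorem map_mk (hf : IsMVHom f) (hF : IsFilter F) (hP : IsFilter P)
    (h : ∀ a, f a ∈ P ↔ a ∈ F) (a : A) : map f hf hF hP h (mk hF a) = mk hP (f a) := rfl

theorem isMVHom_map (hf : IsMVHom f) (hF : IsFilter F) (hP : IsFilter P)
    (h : ∀ a, f a ∈ P ↔ a ∈ F) : IsMVHom (map f hf hF hP h) where
  map_zero := congrArg (mk hP) hf.map_zero
  map_neg := by rintro ⟨a⟩; exact congrArg (mk hP) (hf.map_neg a)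
  map_oplus := by rintro ⟨a⟩ ⟨b⟩; exact congrArg (mk hP) (hf.map_oplus a b)

theorem map_injective (hf : IsMVHom f) (hF : IsFilter F) (hP : IsFilter P)
    (h : ∀ a, f a ∈ P ↔ a ∈ F) : Function.Injective (map f hf hF hP h) := by
  intro x y hxy
  obtain ⟨a, rfl⟩ := mk_surjective hF x
  obtain ⟨b, rfl⟩ := mk_surjective hF y
  rw [map_mk, map_mk, mk_eq_mk, ← hf.map_imp, ← hf.map_imp, h, h] at hxy
  exact (mk_eq_mk hF).2 hxy

end FilterQuotient

end MVAlgebra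

/-- Finitely many nonnegative rationals have a common denominator. -/
theorem exists_common_denominator {ι : Type u} (s : Finset ι) (r : ι → ℚ)
    (hr : ∀ i ∈ s, 0 ≤ r i) : ∃ N : ℕ, 0 < N ∧ ∀ i ∈ s, ∃ k : ℕ, (k : ℚ) = N * r i := by
  refine ⟨∏ i ∈ s, (r i).den, Finset.prod_pos fun i _ => (r i).den_pos, fun i hi => ?_⟩
  obtain ⟨m, hm⟩ := Finset.dvd_prod_of_mem (fun i => (r i).den) hi
  refine ⟨m * (r i).num.toNat, ?_⟩
  have h1 : (((r i).num.toNat : ℤ) : ℚ) = (r i).num := by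
    rw [Int.toNat_of_nonneg (Rat.num_nonneg.2 (hr i hi))]
  have h2 := Rat.den_mul_eq_num (r i)
  rw [hm]
  push_cast at h1 ⊢
  rw [h1, ← h2]
  ring

/-! ### Finite models of partial subalgebras and the finite embeddability property -/

namespace MonadicMVAlgebra

open MVAlgebra

local infixl:65 " +ₘ " => oplus
local infixl:70 " *ₘ " => prod
local infixr:60 " ⇨ₘ " => imp
local prefix:max "∼ₘ" => neg
local infix:50 " ≤ₘ " => le

open Constants

variable {A : Type u} [MonadicMVAlgebra A]

/-- Index `i` is a witnessing prime filter for `i`, and `r i` is a scaled rational functional on the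
Chang group of its quotient. The clauses are the arithmetic that survives: additivity, agreement on
constants, the chain dichotomy, integrality on `T`, and attainment of `∃i` at `i`. -/
theorem exists_rat_values {Q : Set (Constants A)} (hQ : IsPrimeFilter Q) {T : Set A}
    (hT : T.Finite) :
    ∃ r : T → A → ℚ,
      (∀ i x y, r i (x +ₘ y) + r i (x *ₘ y) = r i x + r i y) ∧
      (∀ i, r i zero = 0) ∧
      (∀ i j, ∀ c : Constants A, r i c.1 = r j c.1) ∧
      (∀ i x y, r i (x *ₘ y) = 0 ∨ r i (x +ₘ y) = r i one) ∧
      (∀ i, ∀ t ∈ T, ∃ k : ℕ, (k : ℚ) = r i t) ∧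
      ∀ i : T, r i i.1 = r i (ex i.1) ∧ (ofEx i.1 ∉ neg ⁻¹' Q → 0 < r i i.1) := by
  classical
  have := hT.fintype
  choose P hP hPQ hPw using fun i : T => exists_witness hQ i.1
  have hQc : IsChain (FilterQuotient hQ.toIsFilter) := FilterQuotient.isChain hQ
  have hPc : ∀ i, IsChain (FilterQuotient (hP i).toIsFilter) := fun i =>
    FilterQuotient.isChain (hP i)
  let π := fun i => FilterQuotient.mk (hP i).toIsFilter
  have hπ : ∀ i, IsMVHom (π i) := fun i => FilterQuotient.isMVHom_mk _
  let γ : ∀ i, A → Chang (FilterQuotient (hP i).toIsFilter) := fun i a => Chang.emb (π i a)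
  let f := fun i => FilterQuotient.map (fun c : Constants A => c.1) isMVHom_val hQ.toIsFilter
    (hP i).toIsFilter (hPQ i)
  have hf : ∀ i, IsMVHom (f i) := fun i => FilterQuotient.isMVHom_map _ _ _ _
  have hfi : ∀ i, Function.Injective (f i) := fun i => FilterQuotient.map_injective _ _ _ _
  let s : Finset (Σ i, Chang (FilterQuotient (hP i).toIsFilter)) :=
    (Finset.univ : Finset (T × T)).image fun p => ⟨p.1, γ p.1 p.2.1⟩
  obtain ⟨φ, hφJ, hφ⟩ := exists_addMonoidHom_rat_amalgam
    (fun i => Chang.map (f i) (hf i) (hfi i))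
    (fun i d => Chang.map_nonneg_iff (hf i) (hfi i))
    (s.filter fun k => 0 < k.2) (fun k hk => (Finset.mem_filter.1 hk).2)
  have hpos : ∀ i, ∀ t ∈ T, 0 < γ i t → 0 < φ i (γ i t) := fun i t ht h =>
    hφ ⟨i, γ i t⟩ (Finset.mem_filter.2
      ⟨Finset.mem_image.2 ⟨(i, ⟨t, ht⟩), Finset.mem_univ _, rfl⟩, h⟩)
  have hnonneg : ∀ i, ∀ t ∈ T, 0 ≤ φ i (γ i t) := fun i t ht => by
    rcases (Chang.emb_nonneg (π i t)).eq_or_lt with h | h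
    · change 0 ≤ φ i (Chang.emb (π i t))
      rw [← h, map_zero]
    · exact (hpos i t ht h).le
  obtain ⟨N, hN, hNk⟩ := exists_common_denominator (Finset.univ : Finset (T × T))
    (fun p => φ p.1 (γ p.1 p.2.1)) (fun p _ => hnonneg p.1 p.2.1 p.2.2)
  have hconst : ∀ i (c : Constants A), γ i c.1 =
      Chang.map (f i) (hf i) (hfi i) (Chang.emb (FilterQuotient.mk hQ.toIsFilter c)) :=
    fun i c => (Chang.map_emb (hf i) (hfi i) (FilterQuotient.mk hQ.toIsFilter c)).symm
  have hex : ∀ i : T, π i i.1 = π i (ex i.1) := fun i =>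
    (FilterQuotient.mk_eq_mk _).2 ⟨(hP i).mem_of_le (hP i).one_mem (by
      rw [show i.1 ⇨ₘ ex i.1 = one from le_ex _]; exact le_refl _), hPw i⟩
  refine ⟨fun i a => N * φ i (γ i a), ?_, ?_, ?_, ?_, ?_, ?_⟩
  · intro i x y
    rw [← mul_add, ← mul_add, ← map_add, ← map_add]
    change _ * φ i (Chang.emb _ + Chang.emb _) = _
    rw [(hπ i).map_oplus, (hπ i).map_prod, Chang.emb_oplus_add_emb_prod]
  · intro i
    change _ * φ i (Chang.emb _) = _
    rw [(hπ i).map_zero, Chang.emb_zero, map_zero, mul_zero]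
  · intro i j c
    simp only
    rw [hconst, hconst, hφJ i j]
  · intro i x y
    by_cases h : π i x +ₘ π i y = one
    · right
      change _ * φ i (Chang.emb _) = _ * φ i (Chang.emb _)
      rw [(hπ i).map_oplus, h, (hπ i).map_one]
    · left
      change _ * φ i (Chang.emb _) = _
      rw [(hπ i).map_prod, prod_eq_zero_of_oplus_ne_one h, Chang.emb_zero, map_zero, mul_zero]
  · intro i t ht
    exact hNk (i, ⟨t, ht⟩) (Finset.mem_univ _)
  · intro i
    refine ⟨?_, fun h => ?_⟩
    · change _ * φ i (Chang.emb _) = _ * φ i (Chang.emb _)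
      rw [hex]
    · refine mul_pos (by exact_mod_cast hN) (hpos i i.1 i.2 (Chang.emb_pos fun h0 => h ?_))
      rw [hex] at h0
      rw [Set.mem_preimage, ← hPQ i]
      refine (FilterQuotient.mk_eq_one (hP i).toIsFilter).1 ?_
      change π i (∼ₘ(ex i.1)) = one
      rw [(hπ i).map_neg, h0]; rfl

theorem exists_funModel {Q : Set (Constants A)} (hQ : IsPrimeFilter Q) {S : Set A}
    (hS : S.Finite) :
    ∃ (X : Type u) (_ : Fintype X) (n : ℕ) (h : A → FunModel X n), IsLocalHom S h ∧
      ∀ a ∈ S, ∀ b ∈ S, ofAll (a ⇨ₘ b) ∉ Q → h a ≠ h b := by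
  classical
  -- Negations supply witnesses for `∀a = ¬∃¬a`. The products `y*¬x` serve both for monotonicity and
  -- as separating indices.
  set S' : Set A := S ∪ neg '' S
  set T : Set A := insert one (S' ∪ Set.image2 prod S' S')
  have hS'f : S'.Finite := hS.union (hS.image _)
  have hT : T.Finite := (hS'f.union (hS'f.image2 _ hS'f)).insert _
  have hST' : ∀ {a}, a ∈ S → a ∈ S' := fun h => Or.inl h
  have hneg' : ∀ {a}, a ∈ S → ∼ₘa ∈ S' := fun h => Or.inr ⟨_, h, rfl⟩
  have hS'T : ∀ {a}, a ∈ S' → a ∈ T := fun h => Or.inr (Or.inl h)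
  have hprodT : ∀ {a b}, a ∈ S' → b ∈ S' → a *ₘ b ∈ T := fun ha hb =>
    Or.inr (Or.inr ⟨_, ha, _, hb, rfl⟩)
  have hone : one ∈ T := Or.inl rfl
  obtain ⟨r, hadd, hzero, hconst, hor, hnat, hwit⟩ := exists_rat_values hQ hT
  have hnn : ∀ i, ∀ t ∈ T, 0 ≤ r i t := fun i t ht => by
    obtain ⟨k, hk⟩ := hnat i t ht
    rw [← hk]; exact Nat.cast_nonneg k
  have hneg : ∀ i x, r i (∼ₘx) = r i one - r i x := fun i x => by
    have := hadd i x (∼ₘx)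
    rw [oplus_neg_self, prod_neg_self, hzero] at this
    linarith
  have hle : ∀ i, ∀ x ∈ S, r i x ≤ r i one := fun i x hx => by
    have := hnn i _ (hS'T (hneg' hx))
    rw [hneg] at this
    linarith
  have hmono : ∀ i x y, x ≤ₘ y → y *ₘ ∼ₘx ∈ T → r i x ≤ r i y := fun i x y hxy h => by
    have h1 := hadd i y (∼ₘx)
    have h2 : y +ₘ ∼ₘx = one := by rw [oplus_comm]; exact hxy
    rw [h2, hneg] at h1
    have := hnn i _ h
    linarith
  have hk : ∀ i a, ∃ k : ℕ, a ∈ T → (k : ℚ) = r i a := fun i a => by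
    by_cases ha : a ∈ T
    · obtain ⟨k, hk⟩ := hnat i a ha; exact ⟨k, fun _ => hk⟩
    · exact ⟨0, fun h => absurd h ha⟩
  choose k hk using hk
  -- The index is immaterial, since `1` is a constant and has the same value everywhere.
  set n := k ⟨one, hone⟩ one with hn
  have hnone : ∀ i, (n : ℚ) = r i one := fun i => by
    rw [hn, hk _ _ hone]; exact hconst _ _ (one : Constants A)
  have hkS : ∀ i, ∀ a ∈ S, (k i a : ℚ) = r i a := fun i a ha => hk i a (hS'T (hST' ha))
  have hkn : ∀ i, ∀ a ∈ S, k i a ≤ n := fun i a ha => by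
    have := hle i a ha
    rw [← hkS i a ha, ← hnone] at this
    exact_mod_cast this
  have : Fintype T := hT.fintype
  -- The truncation by `n` acts only outside `S`.
  refine ⟨T, this, n, fun a => ⟨fun i => min n (k i a), fun i => min_le_left _ _⟩, ?_, ?_⟩
  · refine ⟨fun h0 => ?_, fun a ha ha' => ?_, fun a ha b hb hab => ?_, fun a ha ha' => ?_,
      fun a ha ha' => ?_⟩
    · ext i
      have h := hkS i _ h0
      rw [hzero, Nat.cast_eq_zero] at h
      change min n (k i zero) = 0
      omega
    · ext i
      rw [FunModel.neg_val]
      have h1 := hneg i a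
      rw [← hkS i _ ha', ← hkS i _ ha, ← hnone, eq_sub_iff_add_eq] at h1
      norm_cast at h1
      simp only
      omega
    · ext i
      rw [FunModel.oplus_val]
      have h1 := hadd i a b
      have h2 := hor i a b
      have hab' := hprodT (hST' ha) (hST' hb)
      rw [← hkS i _ hab, ← hkS i _ ha, ← hkS i _ hb, ← hk i _ hab'] at h1
      rw [← hkS i _ hab, ← hk i _ hab', ← hnone] at h2
      norm_cast at h1 h2
      have := hkn i _ hab
      simp only
      omega
    · ext i
      rw [FunModel.ex_eq_sup]
      have hc : ∀ j, k j (ex a) = k i (ex a) := fun j => by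
        have h := hconst j i (ofEx a)
        change r j (ex a) = r i (ex a) at h
        rw [← hkS j _ ha', ← hkS i _ ha'] at h
        exact_mod_cast h
      have hm : ∀ j, k j a ≤ k j (ex a) := fun j => by
        have h := hmono j _ _ (le_ex a) (hprodT (hST' ha') (hneg' ha))
        rw [← hkS j _ ha', ← hkS j _ ha] at h
        exact_mod_cast h
      obtain ⟨j, hj⟩ := FunModel.exists_eq_sup
        (⟨fun i => min n (k i a), fun i => min_le_left _ _⟩ : FunModel T n) i
      have hw := (hwit ⟨a, hS'T (hST' ha)⟩).1
      rw [← hkS _ _ ha', ← hkS _ _ ha, Nat.cast_inj] at hw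
      have h1 := FunModel.le_sup
        (⟨fun i => min n (k i a), fun i => min_le_left _ _⟩ : FunModel T n)
        ⟨a, hS'T (hST' ha)⟩ i
      have h2 := hm j
      have h3 := hc j
      have h4 := hc ⟨a, hS'T (hST' ha)⟩
      simp only at hj h1 ⊢
      omega
    · ext i
      rw [FunModel.all_eq_inf]
      have hc : ∀ j, k j (all a) = k i (all a) := fun j => by
        have h := hconst j i (ofAll a)
        change r j (all a) = r i (all a) at h
        rw [← hkS j _ ha', ← hkS i _ ha'] at h
        exact_mod_cast h
      have hm : ∀ j, k j (all a) ≤ k j a := fun j => by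
        have h := hmono j _ _ (all_le a) (hprodT (hST' ha) (hneg' ha'))
        rw [← hkS j _ ha', ← hkS j _ ha] at h
        exact_mod_cast h
      obtain ⟨j, hj⟩ := FunModel.exists_eq_inf
        (⟨fun i => min n (k i a), fun i => min_le_left _ _⟩ : FunModel T n) i
      have hw := (hwit ⟨∼ₘa, hS'T (hneg' ha)⟩).1
      simp only [ex_neg, hneg, sub_right_inj] at hw
      rw [← hkS _ _ ha', ← hkS _ _ ha, Nat.cast_inj] at hw
      have h1 := FunModel.inf_le
        (⟨fun i => min n (k i a), fun i => min_le_left _ _⟩ : FunModel T n)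
        ⟨∼ₘa, hS'T (hneg' ha)⟩ i
      have h2 := hm j
      have h3 := hc j
      have h4 := hc ⟨∼ₘa, hS'T (hneg' ha)⟩
      simp only at hj h1 ⊢
      omega
  · intro a ha b hb hab heq
    have hT' : a *ₘ ∼ₘb ∈ T := hprodT (hST' ha) (hneg' hb)
    -- At the index `a*¬b` this element has positive value, because `¬∃(a*¬b) = ∀(a → b)` is not in
    -- `Q`. The dichotomy then makes that value equal to the difference of the values of `a` and
    -- `b`.
    have hpos := (hwit ⟨a *ₘ ∼ₘb, hT'⟩).2 (fun h => hab (by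
      have : ∼ₘ(ofEx (a *ₘ ∼ₘb)) = ofAll (a ⇨ₘ b) := Subtype.ext (by
        change ∼ₘ(ex (a *ₘ ∼ₘb)) = all (a ⇨ₘ b)
        rw [← neg_imp, ex_neg, MVAlgebra.neg_neg])
      rw [← this]; exact h))
    set i : T := ⟨a *ₘ ∼ₘb, hT'⟩
    have h1 := hadd i a (∼ₘb)
    have h2 := (hor i a (∼ₘb)).resolve_left hpos.ne'
    rw [h2, hneg] at h1
    have h3 : (k i b : ℚ) < k i a := by
      rw [hkS i b hb, hkS i a ha]
      have : 0 < r i (a *ₘ ∼ₘb) := hpos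
      linarith
    have h4 : k i b < k i a := by exact_mod_cast h3
    have h5 := congrFun (congrArg FunModel.val heq) i
    have := hkn i a ha
    simp only at h5
    omega

theorem eq_of_ofAll_imp_eq_one {a b : A} (hab : ofAll (a ⇨ₘ b) = one)
    (hba : ofAll (b ⇨ₘ a) = one) : a = b := by
  have key : ∀ x y : A, ofAll (x ⇨ₘ y) = one → x ≤ₘ y := fun x y h => by
    have h1 : all (x ⇨ₘ y) = one := congrArg Subtype.val h
    have h2 := all_le (x ⇨ₘ y)
    rw [h1] at h2
    exact eq_one_of_one_le h2
  exact le_antisymm (key _ _ hab) (key _ _ hba)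

theorem hasFEP_MMVFSI : HasFEP.{u} (fun A [MonadicMVAlgebra A] => MMVFSI A) := by
  intro A _ hA S hS
  -- The one-element algebra has no prime filter, but it is finite and serves as its own model.
  by_cases h01 : (zero : A) = one
  · have hsub : ∀ x : A, x = zero := fun x => by rw [← prod_one x, ← h01, prod_zero]
    have : Subsingleton A := ⟨fun x y => by rw [hsub x, hsub y]⟩
    exact ⟨A, inferInstance, inferInstance, hA, id, ⟨fun _ _ _ _ h => h, fun _ => rfl, fun _ => rfl,
      fun _ _ _ => rfl, fun _ _ _ _ _ => rfl, fun _ _ _ _ _ => rfl, fun _ _ _ _ _ => rfl,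
      fun _ _ _ _ _ => rfl, fun _ _ _ _ _ => rfl, fun _ _ _ => rfl, fun _ _ _ => rfl⟩⟩
  obtain ⟨X, _, n, h, hh, hsep⟩ := exists_funModel (isPrimeFilter_singleton_one hA h01)
    (finite_step (finite_step (finite_step (finite_step (finite_step hS)))))
  refine ⟨FunModel X n, inferInstance, inferInstance, FunModel.isFSI X n, h,
    hh.isPartialEmbedding fun a ha b hb hab => ?_⟩
  have hmem : ∀ {x : A}, x ∈ S → x ∈ step (step (step (step (step S)))) := fun hx =>
    subset_step (subset_step (subset_step (subset_step (subset_step hx))))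
  by_contra hne
  by_cases h1 : ofAll (a ⇨ₘ b) = one
  · by_cases h2 : ofAll (b ⇨ₘ a) = one
    · exact hne (eq_of_ofAll_imp_eq_one h1 h2)
    · exact hsep b (hmem hb) a (hmem ha) h2 hab.symm
  · exact hsep a (hmem ha) b (hmem hb) h1 hab

theorem exists_isPrimeFilter_notMem {c : Constants A} (hc : c ≠ one) :
    ∃ Q : Set (Constants A), IsPrimeFilter Q ∧ c ∉ Q := by
  obtain ⟨Q, hQ, -, hQc⟩ := exists_isPrimeFilter (isFilter_singleton_one (Constants A))
    (Set.singleton_nonempty c) (by simpa using hc.symm) (by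
      rintro _ rfl _ rfl
      exact ⟨_, rfl, MVAlgebra.imp_self _, MVAlgebra.imp_self _⟩)
  exact ⟨Q, hQ, Set.disjoint_singleton_right.1 hQc⟩

theorem hasFEP_MMV : HasFEP.{u} (fun A [MonadicMVAlgebra A] => MMV A) := by
  intro A _ _ S hS
  let T := step (step (step (step (step S))))
  have hT : T.Finite := finite_step (finite_step (finite_step (finite_step (finite_step hS))))
  have hST : S ⊆ T := fun x hx =>
    subset_step (subset_step (subset_step (subset_step (subset_step hx))))
  -- One factor for each pair in `S` with `a ≰ b`, using a prime filter of constants that omits `∀(a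
  -- → b)`.
  let I := {p : A × A // p ∈ S ×ˢ S ∧ ofAll (p.1 ⇨ₘ p.2) ≠ one}
  have : Finite I := ((hS.prod hS).subset fun p hp => hp.1 :
    {p : A × A | p ∈ S ×ˢ S ∧ ofAll (p.1 ⇨ₘ p.2) ≠ one}.Finite)
  choose Q hQ hQI using fun p : I => exists_isPrimeFilter_notMem p.2.2
  choose X hX n h hh hsep using fun p : I => exists_funModel (hQ p) hT
  refine ⟨∀ p, FunModel (X p) (n p), inferInstance, inferInstance, trivial, fun a p => h p a,
    IsLocalHom.isPartialEmbedding ⟨fun h0 => funext fun p => (hh p).map_zero h0,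
      fun a ha ha' => funext fun p => (hh p).map_neg a ha ha',
      fun a ha b hb hab => funext fun p => (hh p).map_oplus a ha b hb hab,
      fun a ha ha' => funext fun p => (hh p).map_ex a ha ha',
      fun a ha ha' => funext fun p => (hh p).map_all a ha ha'⟩ fun a ha b hb hab => ?_⟩
  have key : ∀ x ∈ S, ∀ y ∈ S, (∀ p, h p x = h p y) → ofAll (x ⇨ₘ y) = one := by
    intro x hx y hy hxy
    by_contra hne
    let p : I := ⟨(x, y), ⟨hx, hy⟩, hne⟩
    exact hsep p x (hST hx) y (hST hy) (hQI p) (hxy p)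
  exact eq_of_ofAll_imp_eq_one (key a ha b hb fun p => congrFun hab p)
    (key b hb a ha fun p => (congrFun hab p).symm)

end MonadicMVAlgebra

theorem mainTheorem5 :
    MonadicMVAlgebra.HasFEP.{u} (fun A [MonadicMVAlgebra A] => MonadicMVAlgebra.MMVFSI A) ∧
      MonadicMVAlgebra.HasFEP.{u} (fun A [MonadicMVAlgebra A] => MonadicMVAlgebra.MMV A) :=
  ⟨MonadicMVAlgebra.hasFEP_MMVFSI, MonadicMVAlgebra.hasFEP_MMV⟩
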